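/- Let $n\ge 2$, $N=\{0,1,\dots,n\}$, let $(e_i)_{i\in N}$ be the standard orthonormal basis of $\mathbb R^N$ and put $e_S=\sum_{i\in S}e_i$ for $S\subseteq N$. Let $\mathbb A_n=\{\pm(e_i-e_j): i<j\}$ be the root system, $A_n$ the lattice it generates, and $P_V(A_n)$ the Voronoi polytope of $A_n$ in the hyperplane $\sum_i x_i=0$. Let $C_{n+1}$ be a Hamiltonian circuit of the complete graph $K_{n+1}$ on the vertex set $N$, let $b_u>0$ be weights on its edges $u$, and let $$Z_b(C_{n+1})=\sum_{u=(i,j)}b_u\,\{\lambda(e_i-e_j):-1\le\lambda\le 1\}$$ (Minkowski sum over the edges of $C_{n+1}$). For a graph $G$ on $N$ with edge weights $b$, the cut function is $\beta_{G,b}(S)=\sum b_u$, summed over the edges $u$ of $G$ with exactly one end in $S$. A cut function on $2^N$ is a function $\beta_{K_{n+1},b}$ with $b\ge 0$. For such $\beta$ let $P(\beta)=\{x\in\mathbb R^N:\sum_{i\in S}x_i\le\beta(S)\text{ for all }S\subsetneq N,\ \sum_{i\in N}x_i=0\}$. Two polytopes have the same type if their face lattices are isomorphic. The type domain of $P(\beta_0)$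 is the connected component containing $\beta_0$ of the set of cut functions $\beta$ for which $P(\beta)$ has the type of $P(\beta_0)$. The facet vectors of $Z_b(C_{n+1})$ are the vectors $\pm e_S$ ($\emptyset\ne S\subseteq N\setminus\{0\}$) that are outer normals of facets. A finite set $X$ of vectors is unimodular if, for every basis $B\subseteq X$ of the span of $X$, all vectors of $X$ have integer coordinates in $B$. The non-rigidity degree $\mathrm{nrd}(L)$ of a lattice $L$ is the dimension of the L-type domain containing its form $\langle x,x\rangle$, i.e. of the set of positive definite quadratic forms on $L$ with the same Delaunay subdivision of $L$. Then: 1. $Z_b(C_{n+1})$ has dimension $n$ and is cubical: for $0\le k\le n-1$ every $k$-face of it is a $k$-dimensional parallelepiped. 2. $Z_b(C_{n+1})$ has the type of $P_V(A_n)$. 3. The facet vectors of $Z_b(C_{n+1})$ are exactly the vectors $\pm e_S$ where $S$ is the vertex set of a (nonempty) subchain of the chain $C_{n+1}-\{0\}$, each facet has exactly one facet vector, and there are $\frac12 n(n+1)$ such subchains. 4. The set of facet vectors of $Z_b(C_{n+1})$ is unimodular, and an invertible linear map carries it onto $\mathbb A_n$, which is the set of facet vectors of $P_V(A_n)$ (the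 lattice vectors $v\in A_n$ for which the hyperplane $\langle v,x\rangle=\frac12\langle v,v\rangle$ cuts $P_V(A_n)$ in a facet). 5. $Z_b(C_{n+1})=P(\beta_{C_{n+1},b})$. The type domain of this polytope is the cone $\mathcal C(C_{n+1})$ of all cut functions $\beta_{C_{n+1},b'}$ with $b'_u>0$ for every edge $u$ of $C_{n+1}$, and it has dimension $n+1$. Moreover $\mathrm{nrd}(A_n)=n+1$. -/

import Mathlib

open scoped Pointwise

noncomputable section

namespace CircuitZonotope

/-! ### Polytopes: dimension, faces, combinatorial type -/

section Polytopes

variable {E : Type*} [NormedAddCommGroup E] [InnerProductSpace ℝ E]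

/-- The (affine) dimension of a subset of a real vector space. -/
def setDim {V : Type*} [AddCommGroup V] [Module ℝ V] (s : Set V) : ℕ :=
  Module.finrank ℝ (vectorSpan ℝ s)

/-- The face lattice of a polytope `P`: all its faces, including `∅` and `P` itself,
ordered by inclusion. -/
abbrev FaceLattice (P : Set E) : Type _ := {F : Set E // IsExposed ℝ P F}

/-- Two polytopes have the same (combinatorial) type: their face lattices are isomorphic. -/
def SameType {E' : Type*} [NormedAddCommGroup E'] [InnerProductSpace ℝ E']
    (P : Set E) (P' : Set E') : Prop :=
  Nonempty (FaceLattice P ≃o FaceLattice P')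

/-- `F` is a `k`-dimensional (nonempty) face of `P`. -/
def IsKFace (P : Set E) (k : ℕ) (F : Set E) : Prop :=
  IsExposed ℝ P F ∧ F.Nonempty ∧ setDim F = k

/-- A facet of `P` is a nonempty face of codimension one in `P`. -/
def IsFacet (P F : Set E) : Prop :=
  IsExposed ℝ P F ∧ F.Nonempty ∧ setDim F + 1 = setDim P

/-- A `k`-dimensional parallelepiped: a translate of `{∑ cᵢ vᵢ : 0 ≤ cᵢ ≤ 1}` for `k` linearly
independent vectors `vᵢ`. -/
def IsKParallelepiped (k : ℕ) (F : Set E) : Prop :=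
  ∃ (a : E) (v : Fin k → E), LinearIndependent ℝ v ∧ F = a +ᵥ parallelepiped v

/-- A `d`-dimensional polytope is cubical if each of its `k`-faces, `0 ≤ k ≤ d - 1`, is a
`k`-dimensional parallelepiped. -/
def IsCubical (P : Set E) : Prop :=
  ∀ k : ℕ, k < setDim P → ∀ F : Set E, IsKFace P k F → IsKParallelepiped k F

/-- The face of `P` on which the linear functional `⟨p, ·⟩` is maximal. -/
def supportFace (P : Set E) (p : E) : Set E :=
  {x ∈ P | ∀ y ∈ P, inner ℝ p y ≤ inner ℝ p x}

/-- A set `X` of vectors is unimodular if for every basic subset `B ⊆ X` (a basis of the span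
of `X`) all vectors of `X` have integer coordinates in `B`. -/
def IsUnimodularSet (X : Set E) : Prop :=
  ∀ B : Set E, B ⊆ X → LinearIndependent ℝ (fun v : B => (v : E)) →
    Submodule.span ℝ B = Submodule.span ℝ X → ∀ x ∈ X, x ∈ Submodule.span ℤ B

/-- Two sets of vectors are equivalent if an invertible linear map carries one onto the other. -/
def LinearlyEquivalent (X Y : Set E) : Prop :=
  ∃ T : E ≃ₗ[ℝ] E, T '' X = Y

/-! ### Lattices: Voronoi polytopes and non-rigidity degree -/

/-- The Voronoi polytope of a lattice `L`, in the space spanned by `L`. -/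
def voronoiPolytope (L : Submodule ℤ E) : Set E :=
  {x | x ∈ Submodule.span ℝ (L : Set E) ∧ ∀ v ∈ L, ‖x‖ ≤ ‖x - v‖}

/-- The facet vectors of the Voronoi polytope of `L`: the lattice vectors `v` whose bisecting
hyperplane `⟨v, x⟩ = ⟨v, v⟩ / 2` carries a facet. -/
def voronoiFacetVectors (L : Submodule ℤ E) : Set E :=
  {v | v ∈ L ∧ IsFacet (voronoiPolytope L)
    {x ∈ voronoiPolytope L | inner ℝ v x = inner ℝ v v / 2}}

/-- The real quadratic forms on the space spanned by the lattice `L`. (In coordinates with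
respect to a basis of `L`, these are the quadratic forms on `ℤⁿ`.) -/
abbrev LatticeForm (L : Submodule ℤ E) : Type _ :=
  QuadraticForm ℝ (Submodule.span ℝ (L : Set E))

/-- The Delaunay subdivision of the lattice `L` with respect to the form `f`, each cell given by
its vertex set: the cell of the centre `c` consists of the points of `L` closest to `c`. -/
def delaunaySubdivision (L : Submodule ℤ E) (f : LatticeForm L) :
    Set (Set (Submodule.span ℝ (L : Set E))) :=
  {D | ∃ c : Submodule.span ℝ (L : Set E),
    D = {z : Submodule.span ℝ (L : Set E) | (z : E) ∈ L ∧
      ∀ w : Submodule.span ℝ (L : Set E), (w : E) ∈ L → f (z - c) ≤ f (w - c)}}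

/-- The (L-)type domain of a form `f₀` on the lattice `L`: all positive definite forms with
the same Delaunay subdivision as `f₀`. -/
def formTypeDomain (L : Submodule ℤ E) (f₀ : LatticeForm L) : Set (LatticeForm L) :=
  {f | f.PosDef ∧ delaunaySubdivision L f = delaunaySubdivision L f₀}

/-- The form `x ↦ ⟨x, x⟩` of the lattice `L`. -/
def latticeForm (L : Submodule ℤ E) : LatticeForm L :=
  LinearMap.BilinMap.toQuadraticMap (innerₗ (Submodule.span ℝ (L : Set E)))

/-- The non-rigidity degree of a lattice: the dimension of the type domain containing its form. -/
def nrdLattice (L : Submodule ℤ E) : ℕ :=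
  setDim (formTypeDomain L (latticeForm L))

end Polytopes

/-! ### The root system `𝔸ₙ` and the root lattice `Aₙ`, in `ℝ^N` with `N = {0, 1, …, n}` -/

/-- The Euclidean space `ℝ^N`, `N = {0, 1, …, n}`. -/
abbrev Space (n : ℕ) : Type := EuclideanSpace ℝ (Fin (n + 1))

/-- The vector `t(i, j) = eᵢ - eⱼ`. -/
def root {n : ℕ} (i j : Fin (n + 1)) : Space n :=
  EuclideanSpace.single i 1 - EuclideanSpace.single j 1

/-- The root system `𝔸ₙ = {±(eᵢ - eⱼ) : i < j}`. -/
def rootSystem (n : ℕ) : Set (Space n) :=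
  {t | ∃ i j : Fin (n + 1), i < j ∧ (t = root i j ∨ t = -root i j)}

/-- The root lattice `Aₙ`, integrally generated by `𝔸ₙ`. -/
def rootLattice (n : ℕ) : Submodule ℤ (Space n) :=
  Submodule.span ℤ (rootSystem n)

/-- The incidence vector `e_S` of a set `S ⊆ N`. -/
def incidenceVector {n : ℕ} (S : Finset (Fin (n + 1))) : Space n :=
  ∑ i ∈ S, EuclideanSpace.single i 1

/-! ### Graphs on `N`: zonotopes, cut functions, type domains -/

open Classical in
/-- The edges of a graph on `N`, each written as an ordered pair `(i, j)` with `i < j`. -/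
def edgePairs {n : ℕ} (G : SimpleGraph (Fin (n + 1))) : Finset (Fin (n + 1) × Fin (n + 1)) :=
  {u | u.1 < u.2 ∧ G.Adj u.1 u.2}

/-- The segment `z(t) = {c t : -1 ≤ c ≤ 1}`. -/
def zSegment {n : ℕ} (t : Space n) : Set (Space n) :=
  {x | ∃ c : ℝ, -1 ≤ c ∧ c ≤ 1 ∧ x = c • t}

/-- The zonotope `Z_b(G)`: the Minkowski sum of the segments `b_u z(t(u))` over the edges
`u` of `G`. -/
def zonotope {n : ℕ} (G : SimpleGraph (Fin (n + 1))) (b : Sym2 (Fin (n + 1)) → ℝ) :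
    Set (Space n) :=
  ∑ u ∈ edgePairs G, b s(u.1, u.2) • zSegment (root u.1 u.2)

open Classical in
/-- The cut function `β_G(S) = ∑ b_u`, summed over the edges `u` of `G` with one end in `S`
and the other end outside `S`. -/
def cutFunction {n : ℕ} (G : SimpleGraph (Fin (n + 1))) (b : Sym2 (Fin (n + 1)) → ℝ) :
    Finset (Fin (n + 1)) → ℝ :=
  fun S => ∑ u ∈ edgePairs G with (u.1 ∈ S ↔ u.2 ∉ S), b s(u.1, u.2)

/-- The set of all cut functions on `2^N`: those given by nonnegative weights on the edges of
the complete graph. -/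
def cutFunctions (n : ℕ) : Set (Finset (Fin (n + 1)) → ℝ) :=
  {β | ∃ b : Sym2 (Fin (n + 1)) → ℝ, (∀ e, 0 ≤ b e) ∧ β = cutFunction ⊤ b}

/-- The open cone `𝒞(G)` of the cut functions given by positive weights on the edges of `G`. -/
def openCutCone {n : ℕ} (G : SimpleGraph (Fin (n + 1))) : Set (Finset (Fin (n + 1)) → ℝ) :=
  {β | ∃ b : Sym2 (Fin (n + 1)) → ℝ, (∀ e ∈ G.edgeSet, 0 < b e) ∧ β = cutFunction G b}

/-- The base polytope `P(β)`. -/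
def basePolytope {n : ℕ} (β : Finset (Fin (n + 1)) → ℝ) : Set (Space n) :=
  {x | (∀ S : Finset (Fin (n + 1)), S ⊂ Finset.univ → ∑ i ∈ S, x i ≤ β S) ∧ ∑ i, x i = 0}

/-- The type domain of `P(β₀)`: the connected component of `β₀` in the set of all cut functions
`β` for which `P(β)` has the type of `P(β₀)`. -/
def typeDomain {n : ℕ} (β₀ : Finset (Fin (n + 1)) → ℝ) : Set (Finset (Fin (n + 1)) → ℝ) :=
  connectedComponentIn {β | β ∈ cutFunctions n ∧ SameType (basePolytope β) (basePolytope β₀)} β₀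

/-- The facet vectors, among the vectors `±e_S` with `∅ ≠ S ⊆ N - {0}`, of a polytope `P` lying
in the hyperplane `∑ xᵢ = 0`. (On this hyperplane `e_S` and `-e_{N - S}` are the same functional,
whence the normalization `0 ∉ S`.) -/
def facetVectors {n : ℕ} (P : Set (Space n)) : Set (Space n) :=
  {p | (∃ S : Finset (Fin (n + 1)), S.Nonempty ∧ 0 ∉ S ∧
      (p = incidenceVector S ∨ p = -incidenceVector S)) ∧ IsFacet P (supportFace P p)}

/-- `S` is the vertex set of a subchain of `C - {0}`: a nonempty set of vertices different from
`0` which spans a connected subgraph of `C`. -/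
def IsSubchain {n : ℕ} (C : SimpleGraph (Fin (n + 1))) (S : Finset (Fin (n + 1))) : Prop :=
  0 ∉ S ∧ (C.induce (S : Set (Fin (n + 1)))).Connected

/-- `C` is a Hamiltonian circuit of the complete graph on `N`: a graph on `N` isomorphic to the
standard cycle with `n + 1` vertices. -/
def IsHamiltonianCircuit {n : ℕ} (C : SimpleGraph (Fin (n + 1))) : Prop :=
  2 ≤ n ∧ Nonempty (SimpleGraph.cycleGraph (n + 1) ≃g C)

end CircuitZonotope

end

/-! Everything combinatorial follows from one linear fact. The weighted edge vectors of a
Hamiltonian circuit have, up to scaling, a single linear relation, and all its coefficients are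
positive (`IsPositiveCircuit`). The nonempty faces of a zonotope correspond to the sign vectors of
functionals on its generators, and inclusion of faces is read off the signs (`signFace_subset_iff`,
`sameType_zon`). For a positive circuit these sign vectors are the signs of all real vectors with
coordinate sum zero (`IsPositiveCircuit.signVectors_eq`), so the face lattice depends only on the
number of generators. The Voronoi polytope of the root lattice is the zonotope of the halved
projections of the basis vectors, which sum to zero (`voronoiPolytope_rootLattice`,
`isPositiveCircuit_halfProj`); hence the equality of types. Dropping any generator leaves
independent vectors, so proper faces are parallelepipeds, and facets have exactly one plus, one
minus and zeros elsewhere.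

A functional that vanishes at vertex 0 is recovered from its differences along the circuit by tail
sums. The linear map `tailSum` therefore carries roots to facet vectors, and a root goes to plus or
minus the incidence vector of an arc avoiding 0. This gives the subchains, their number, and
unimodularity by transport from the root system.

The support function of a graph zonotope is the sum of b|p_i - p_j|. Peeling off upper level sets of
p reduces its inequalities to those for sets, so the zonotope is P(β). For the type domain, faces
are counted: if the support of one graph strictly contains that of another and a suitable pair of
functionals exists, the larger graph has strictly more sign vectors. Adding a chord to the circuit,
or deleting an edge from it, thus changes the type. Two disjoint open conditions on the weights then
confine the connected component to the cone of the circuit.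

For the non-rigidity degree, all forms ∑ a_k x_k² with a > 0 have the same Delaunay subdivision:
moving the centre off the hyperplane makes the closest-point problem separate into coordinates, with
an answer independent of a. Conversely, a form with this subdivision makes roots with disjoint
supports orthogonal, because they span a parallelogram with all its vertices in one cell, and this
forces the form to be diagonal. -/

noncomputable section

namespace CircuitZonotope

/-! ### Faces of zonotopes -/

section Zonotopes

variable {ι E E' : Type*} [Fintype ι] [NormedAddCommGroup E] [InnerProductSpace ℝ E]
  [NormedAddCommGroup E'] [InnerProductSpace ℝ E']

/-- The zonotope `∑ [-1, 1] vᵢ` of a finite family of vectors. -/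
def zon (v : ι → E) : Set E :=
  {x | ∃ c : ι → ℝ, (∀ i, |c i| ≤ 1) ∧ ∑ i, c i • v i = x}

/-- The points of the zonotope whose coefficients are prescribed by the nonzero signs of `σ`. -/
def signFace (v : ι → E) (σ : ι → SignType) : Set E :=
  {x | ∃ c : ι → ℝ, (∀ i, |c i| ≤ 1) ∧ (∀ i, σ i ≠ 0 → c i = σ i) ∧ ∑ i, c i • v i = x}

/-- The signs of a functional on a family of vectors. -/
def dualSign (v : ι → E) (l : StrongDual ℝ E) : ι → SignType :=
  fun i => SignType.sign (l (v i))

/-- All sign vectors of functionals on a family of vectors. -/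
def signVectors (v : ι → E) : Set (ι → SignType) :=
  Set.range (dualSign v)

lemma abs_signType_le_one (s : SignType) : |(s : ℝ)| ≤ 1 := by
  cases s <;> simp

lemma mul_le_abs_of_abs_le_one {c y : ℝ} (hc : |c| ≤ 1) : c * y ≤ |y| := by
  calc c * y ≤ |c * y| := le_abs_self _
    _ = |c| * |y| := abs_mul _ _
    _ ≤ 1 * |y| := by gcongr
    _ = |y| := one_mul _

lemma eq_sign_of_mul_eq_abs {c y : ℝ} (h : c * y = |y|) (hy : y ≠ 0) :
    c = (SignType.sign y : ℝ) := by
  have : c * y = (SignType.sign y : ℝ) * y := by rw [h, sign_mul_self]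
  exact mul_right_cancel₀ hy this

lemma sum_mul_eq_sum_abs {c y : ι → ℝ} (hc : ∀ i, |c i| ≤ 1)
    (h : ∑ i, |y i| ≤ ∑ i, c i * y i) (i : ι) : c i * y i = |y i| := by
  have hle : ∀ i ∈ Finset.univ, c i * y i ≤ |y i| := fun i _ => mul_le_abs_of_abs_le_one (hc i)
  exact (Finset.sum_eq_sum_iff_of_le hle).1 (le_antisymm (Finset.sum_le_sum hle) h) i
    (Finset.mem_univ i)

/-- The maximum of `l` is the sum of the `|l (v i)|`. It is attained exactly when each coefficient
with `l (v i) ≠ 0` equals the sign of `l (v i)`; the other coefficients stay free. -/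
lemma supportSet_zon (v : ι → E) (l : StrongDual ℝ E) :
    {x ∈ zon v | ∀ y ∈ zon v, l y ≤ l x} = signFace v (dualSign v l) := by
  ext x
  constructor
  · rintro ⟨⟨c, hc, rfl⟩, hmax⟩
    refine ⟨c, hc, fun i hi => ?_, rfl⟩
    have h := hmax (∑ i, (SignType.sign (l (v i)) : ℝ) • v i)
      ⟨_, fun i => abs_signType_le_one _, rfl⟩
    simp only [map_sum, map_smul, smul_eq_mul, sign_mul_self] at h
    exact eq_sign_of_mul_eq_abs (sum_mul_eq_sum_abs hc h i) (by simpa [dualSign] using hi)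
  · rintro ⟨c, hc, hσ, rfl⟩
    refine ⟨⟨c, hc, rfl⟩, ?_⟩
    rintro _ ⟨d, hd, rfl⟩
    simp only [map_sum, map_smul, smul_eq_mul]
    refine Finset.sum_le_sum fun i _ => (mul_le_abs_of_abs_le_one (hd i)).trans_eq ?_
    by_cases hi : l (v i) = 0
    · simp [hi]
    · rw [hσ i (by simpa [dualSign] using hi), dualSign, sign_mul_self]

lemma signFace_nonempty (v : ι → E) (σ : ι → SignType) : (signFace v σ).Nonempty :=
  ⟨_, fun i => (σ i : ℝ), fun _ => abs_signType_le_one _, fun _ _ => rfl, rfl⟩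

lemma isExposed_zon_iff {v : ι → E} {F : Set E} :
    IsExposed ℝ (zon v) F ↔ F = ∅ ∨ ∃ l, F = signFace v (dualSign v l) := by
  constructor
  · intro h
    rcases F.eq_empty_or_nonempty with h0 | h0
    · exact Or.inl h0
    · obtain ⟨l, hl⟩ := h h0
      exact Or.inr ⟨l, by rw [hl, supportSet_zon]⟩
  · rintro (rfl | ⟨l, rfl⟩)
    · exact fun h => absurd h Set.not_nonempty_empty
    · exact fun _ => ⟨l, (supportSet_zon v l).symm⟩

lemma signFace_subset_iff {v : ι → E} {σ : ι → SignType} {l : StrongDual ℝ E} :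
    signFace v σ ⊆ signFace v (dualSign v l) ↔
      ∀ i, dualSign v l i ≠ 0 → σ i = dualSign v l i := by
  constructor
  · intro h i hi
    -- The centre of the face is the test point: its coefficients are the signs themselves, so
    -- maximality of the functional there forces the signs to agree.
    have hx : ∑ i, (σ i : ℝ) • v i ∈ signFace v σ :=
      ⟨_, fun i => abs_signType_le_one _, fun _ _ => rfl, rfl⟩
    have := h hx
    rw [← supportSet_zon] at this
    have h := this.2 (∑ i, (SignType.sign (l (v i)) : ℝ) • v i)
      ⟨_, fun i => abs_signType_le_one _, rfl⟩
    simp only [map_sum, map_smul, smul_eq_mul, sign_mul_self] at h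
    have h2 := eq_sign_of_mul_eq_abs
      (sum_mul_eq_sum_abs (fun i => abs_signType_le_one (σ i)) h i) (by simpa [dualSign] using hi)
    revert h2
    unfold dualSign
    generalize SignType.sign (l (v i)) = s
    generalize σ i = t
    cases s <;> cases t <;> norm_num
  · rintro h _ ⟨c, hc, hσ, rfl⟩
    exact ⟨c, hc, fun i hi => by rw [hσ i (by rwa [h i hi]), h i hi], rfl⟩

lemma dualSign_eq_of_signFace_eq {v : ι → E} {l l' : StrongDual ℝ E}
    (h : signFace v (dualSign v l) = signFace v (dualSign v l')) :
    dualSign v l = dualSign v l' := by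
  have h1 := signFace_subset_iff.1 h.subset
  have h2 := signFace_subset_iff.1 h.symm.subset
  funext i
  by_cases hi : dualSign v l' i = 0
  · by_contra hne
    exact hne (h2 i (by rwa [hi] at hne)).symm
  · exact h1 i hi

lemma supportFace_zon (v : ι → E) (p : E) :
    supportFace (zon v) p = signFace v (dualSign v (innerSL ℝ p)) :=
  supportSet_zon v (innerSL ℝ p)

/-- The face with a given sign vector, and the empty face for `none`. -/
def faceOfSign (v : ι → E) : Option (signVectors v) → FaceLattice (zon v)
  | none => ⟨∅, isExposed_zon_iff.2 (Or.inl rfl)⟩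
  | some σ => ⟨signFace v σ, isExposed_zon_iff.2 (Or.inr (by
      obtain ⟨l, hl⟩ := σ.2
      exact ⟨l, by rw [hl]⟩))⟩

lemma faceOfSign_bijective (v : ι → E) : Function.Bijective (faceOfSign v) := by
  constructor
  · rintro (_ | ⟨_, l, rfl⟩) (_ | ⟨_, l', rfl⟩) h
    · rfl
    · exact absurd (congrArg Subtype.val h).symm (signFace_nonempty v _).ne_empty
    · exact absurd (congrArg Subtype.val h) (signFace_nonempty v _).ne_empty
    · have := dualSign_eq_of_signFace_eq (congrArg Subtype.val h)
      simp [this]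
  · rintro ⟨F, hF⟩
    rcases isExposed_zon_iff.1 hF with rfl | ⟨l, rfl⟩
    · exact ⟨none, rfl⟩
    · exact ⟨some ⟨_, l, rfl⟩, rfl⟩

/-- Faces of a zonotope are given by its sign vectors, together with the empty face. -/
def faceEquiv (v : ι → E) : Option (signVectors v) ≃ FaceLattice (zon v) :=
  Equiv.ofBijective _ (faceOfSign_bijective v)

lemma natCard_faceLattice_zon (v : ι → E) :
    Nat.card (FaceLattice (zon v)) = (signVectors v).ncard + 1 := by
  rw [← Nat.card_congr (faceEquiv v), Finite.card_option, Nat.card_coe_set_eq]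

/-- By `signFace_subset_iff` the order on faces is visible on the sign vectors alone, so the
generators and the ambient spaces play no further part. -/
lemma sameType_zon {v : ι → E} {w : ι → E'} (h : signVectors v = signVectors w) :
    SameType (zon v) (zon w) := by
  let e : Option (signVectors v) ≃ Option (signVectors w) := Equiv.optionCongr (Equiv.setCongr h)
  refine ⟨⟨(faceEquiv v).symm.trans (e.trans (faceEquiv w)), ?_⟩⟩
  intro F G
  obtain ⟨F, rfl⟩ := (faceEquiv v).surjective F
  obtain ⟨G, rfl⟩ := (faceEquiv v).surjective G
  simp only [Equiv.trans_apply, Equiv.symm_apply_apply]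
  rcases F with _ | ⟨σ, hσ⟩ <;> rcases G with _ | ⟨τ, hτ⟩
  · exact Iff.intro (fun _ => Set.empty_subset _) (fun _ => Set.empty_subset _)
  · exact Iff.intro (fun _ => Set.empty_subset _) (fun _ => Set.empty_subset _)
  · constructor
    · exact fun h => absurd (Set.subset_empty_iff.1 h) (signFace_nonempty w σ).ne_empty
    · exact fun h => absurd (Set.subset_empty_iff.1 h) (signFace_nonempty v σ).ne_empty
  · change signFace w σ ⊆ signFace w τ ↔ signFace v σ ⊆ signFace v τ
    obtain ⟨l', hl'⟩ : τ ∈ signVectors w := h ▸ hτ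
    obtain ⟨l, rfl⟩ := hτ
    rw [signFace_subset_iff, ← hl', signFace_subset_iff, hl']

lemma SameType.symm {P : Set E} {P' : Set E'} (h : SameType P P') : SameType P' P :=
  h.map OrderIso.symm

lemma SameType.natCard_eq {P : Set E} {P' : Set E'} (h : SameType P P') :
    Nat.card (FaceLattice P) = Nat.card (FaceLattice P') :=
  Nat.card_congr h.some.toEquiv

lemma vectorSpan_signFace (v : ι → E) (σ : ι → SignType) :
    vectorSpan ℝ (signFace v σ) = Submodule.span ℝ (v '' {i | σ i = 0}) := by
  classical
  apply le_antisymm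
  · rw [vectorSpan_def, Submodule.span_le]
    rintro _ ⟨_, ⟨c, -, hc, rfl⟩, _, ⟨d, -, hd, rfl⟩, rfl⟩
    simp only [vsub_eq_sub, ← Finset.sum_sub_distrib, ← sub_smul, SetLike.mem_coe]
    refine Submodule.sum_mem _ fun i _ => ?_
    by_cases hi : σ i = 0
    · exact Submodule.smul_mem _ _ (Submodule.subset_span ⟨i, hi, rfl⟩)
    · simp [hc i hi, hd i hi]
  · rw [Submodule.span_le]
    rintro _ ⟨i, hi, rfl⟩
    have h1 : ∑ j, (σ j : ℝ) • v j ∈ signFace v σ :=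
      ⟨_, fun i => abs_signType_le_one _, fun _ _ => rfl, rfl⟩
    -- Raising one free coefficient from 0 to 1 moves the centre of the face by exactly `v i`.
    have h2 : ∑ j, (if j = i then (1 : ℝ) else σ j) • v j ∈ signFace v σ := by
      refine ⟨_, fun j => ?_, fun j hj => ?_, rfl⟩
      · split_ifs
        · simp
        · exact abs_signType_le_one _
      · rw [if_neg]
        rintro rfl
        exact hj hi
    have h3 := vsub_mem_vectorSpan ℝ h2 h1
    rw [vsub_eq_sub, ← Finset.sum_sub_distrib, Finset.sum_eq_single i] at h3
    · simpa [show σ i = 0 from hi] using h3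
    · intro j _ hj
      simp [hj]
    · simp

lemma zon_eq_signFace (v : ι → E) : zon v = signFace v 0 := by
  simp [zon, signFace]

lemma isKParallelepiped_signFace {v : ι → E} {σ : ι → SignType} {k : ℕ}
    (hv : LinearIndependent ℝ fun i : {i // σ i = 0} => v i) (hk : setDim (signFace v σ) = k) :
    IsKParallelepiped k (signFace v σ) := by
  classical
  have hcard : Fintype.card {i // σ i = 0} = k := by
    rw [← hk, setDim, vectorSpan_signFace, ← finrank_span_eq_card hv, Set.image_eq_range]
    rfl
  let e : Fin k ≃ {i // σ i = 0} := (finCongr hcard.symm).trans (Fintype.equivFin _).symm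
  have hsum : ∀ g : ι → E, ∑ i, g i = ∑ i : {i // σ i ≠ 0}, g i + ∑ j, g (e j) := by
    intro g
    rw [Equiv.sum_comp e (fun i => g i), add_comm]
    exact (Fintype.sum_subtype_add_sum_subtype (fun i => σ i = 0) g).symm
  -- The corner has all free coefficients equal to -1; the interval [-1, 1] has length 2, whence the
  -- doubled edges.
  refine ⟨∑ i : {i // σ i ≠ 0}, (σ i : ℝ) • v i - ∑ j, v (e j), fun j => (2 : ℝ) • v (e j), ?_, ?_⟩
  · exact (hv.comp e e.injective).units_smul (fun _ => Units.mk0 (2 : ℝ) two_ne_zero)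
  · ext x
    rw [Set.mem_vadd_set]
    constructor
    · rintro ⟨c, hc, hσ, rfl⟩
      refine ⟨∑ j, ((c (e j) + 1) / 2) • (2 : ℝ) • v (e j), ?_, ?_⟩
      · rw [mem_parallelepiped_iff]
        refine ⟨fun j => (c (e j) + 1) / 2, ⟨fun j => ?_, fun j => ?_⟩, rfl⟩
        · have := (abs_le.1 (hc (e j))).1
          simp only [Pi.zero_apply]
          linarith
        · have := (abs_le.1 (hc (e j))).2
          simp only [Pi.one_apply]
          linarith
      · rw [hsum fun i => c i • v i, vadd_eq_add, sub_add, ← Finset.sum_sub_distrib,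
          sub_eq_add_neg, ← Finset.sum_neg_distrib]
        congr 1
        · exact Finset.sum_congr rfl fun i _ => by rw [hσ i i.2]
        · refine Finset.sum_congr rfl fun j _ => ?_
          module
    · rintro ⟨y, hy, rfl⟩
      rw [mem_parallelepiped_iff] at hy
      obtain ⟨d, ⟨hd0, hd1⟩, rfl⟩ := hy
      refine ⟨fun i => if h : σ i = 0 then 2 * d (e.symm ⟨i, h⟩) - 1 else σ i, fun i => ?_,
        fun i hi => dif_neg hi, ?_⟩
      · dsimp only
        split_ifs with h
        · have h0 := hd0 (e.symm ⟨i, h⟩)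
          have h1 := hd1 (e.symm ⟨i, h⟩)
          simp only [Pi.zero_apply, Pi.one_apply] at h0 h1
          rw [abs_le]
          constructor <;> linarith
        · exact abs_signType_le_one _
      · rw [hsum, vadd_eq_add, sub_add, ← Finset.sum_sub_distrib, sub_eq_add_neg,
          ← Finset.sum_neg_distrib]
        congr 1
        · exact Finset.sum_congr rfl fun i _ => by
            dsimp only
            rw [dif_neg i.2]
        · refine Finset.sum_congr rfl fun j _ => ?_
          dsimp only
          rw [dif_pos (e j).2]
          simp only [Subtype.coe_eta, Equiv.symm_apply_apply]
          module

end Zonotopes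

/-! ### Zonotopes of families with a single, positive, linear relation -/

section Circuits

variable {ι E E' : Type*} [Fintype ι] [NormedAddCommGroup E] [InnerProductSpace ℝ E]
  [NormedAddCommGroup E'] [InnerProductSpace ℝ E']

/-- A family of vectors whose linear relations are the multiples of one relation with positive
coefficients `a`; in dual terms, the values of functionals on it are exactly the families
orthogonal to `a`. -/
def IsPositiveCircuit (v : ι → E) : Prop :=
  ∃ a : ι → ℝ, (∀ i, 0 < a i) ∧ ∑ i, a i • v i = 0 ∧
    ∀ q : ι → ℝ, ∑ i, a i * q i = 0 → ∃ l : StrongDual ℝ E, ∀ i, l (v i) = q i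

/-- The sign vector with a plus at `i`, a minus at `j` and zeros elsewhere. -/
def pairSign {κ : Type*} [DecidableEq κ] (i j : κ) : κ → SignType :=
  fun m => if m = i then 1 else if m = j then -1 else 0

lemma pairSign_left {κ : Type*} [DecidableEq κ] (i j : κ) : pairSign i j i = 1 := by
  simp [pairSign]

lemma pairSign_ne_zero_iff {κ : Type*} [DecidableEq κ] {i j m : κ} :
    pairSign i j m ≠ 0 ↔ m = i ∨ m = j := by
  by_cases h1 : m = i
  · simp [pairSign, h1]
  · by_cases h2 : m = j
    · subst h2
      simp [pairSign, h1]
    · simp [pairSign, h1, h2]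

lemma sign_mul_of_pos {a q : ℝ} (ha : 0 < a) : SignType.sign (a * q) = SignType.sign q := by
  rw [sign_mul, sign_pos ha, one_mul]

/-- Rescaling the values by the positive `a i` keeps the signs and turns orthogonality to `a` into
sum zero. The answer no longer mentions `v` or `a`. -/
lemma IsPositiveCircuit.signVectors_eq {v : ι → E} (hv : IsPositiveCircuit v) :
    signVectors v = {σ | ∃ q : ι → ℝ, ∑ i, q i = 0 ∧ σ = fun i => SignType.sign (q i)} := by
  obtain ⟨a, ha, hsum, hdual⟩ := hv
  ext σ
  constructor
  · rintro ⟨l, rfl⟩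
    refine ⟨fun i => a i * l (v i), by simpa using congrArg l hsum, ?_⟩
    funext i
    rw [sign_mul_of_pos (ha i), dualSign]
  · rintro ⟨q, hq, rfl⟩
    obtain ⟨l, hl⟩ := hdual (fun i => (a i)⁻¹ * q i) (by
      rw [← hq]
      exact Finset.sum_congr rfl fun i _ => mul_inv_cancel_left₀ (ha i).ne' _)
    refine ⟨l, ?_⟩
    funext i
    rw [dualSign, hl, sign_mul_of_pos (inv_pos.2 (ha i))]

lemma IsPositiveCircuit.sameType {v : ι → E} {w : ι → E'} (hv : IsPositiveCircuit v)
    (hw : IsPositiveCircuit w) : SameType (zon v) (zon w) :=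
  sameType_zon (hv.signVectors_eq.trans hw.signVectors_eq.symm)

lemma IsPositiveCircuit.linearIndependent {v : ι → E} (hv : IsPositiveCircuit v) {p : ι → Prop}
    {k : ι} (hk : ¬ p k) : LinearIndependent ℝ fun i : {i // p i} => v i := by
  classical
  obtain ⟨a, ha, hsum, hdual⟩ := hv
  rw [Fintype.linearIndependent_iff]
  intro g hg i
  have hik : k ≠ i := by
    rintro rfl
    exact hk i.2
  -- A functional nonzero only on `v i` and `v k` exists because these two values cancel against
  -- `a`. Since `k` is outside the family, it isolates the coefficient `g i`.
  obtain ⟨l, hl⟩ := hdual (fun m => if m = i then (a i)⁻¹ else if m = k then -(a k)⁻¹ else 0) (by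
    rw [Fintype.sum_eq_add i.1 k hik.symm]
    · simp [hik, (ha _).ne']
    · rintro m ⟨h1, h2⟩
      simp [h1, h2])
  have h := congrArg l hg
  simp only [map_sum, map_smul, map_zero, hl, smul_eq_mul] at h
  rw [Finset.sum_eq_single i] at h
  · simpa [(ha i).ne'] using h
  · intro j _ hj
    have h1 : (j : ι) ≠ i := fun h => hj (Subtype.ext h)
    have h2 : (j : ι) ≠ k := by
      rintro rfl
      exact hk j.2
    simp [h1, h2]
  · simp

lemma IsPositiveCircuit.setDim_zon {v : ι → E} [Nonempty ι] (hv : IsPositiveCircuit v) :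
    setDim (zon v) + 1 = Fintype.card ι := by
  classical
  obtain ⟨k⟩ := ‹Nonempty ι›
  have hli := hv.linearIndependent (p := fun i => i ≠ k) (k := k) (by simp)
  obtain ⟨a, ha, hsum, -⟩ := hv
  have hspan : Submodule.span ℝ (v '' {i | (0 : ι → SignType) i = 0}) =
      Submodule.span ℝ (Set.range fun i : {i // i ≠ k} => v i) := by
    apply le_antisymm
    · rw [Submodule.span_le]
      rintro _ ⟨i, -, rfl⟩
      by_cases hi : i = k
      · subst hi
        have h : v i = -((a i)⁻¹ • ∑ j ∈ Finset.univ.erase i, a j • v j) := by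
          rw [← Finset.add_sum_erase _ _ (Finset.mem_univ i)] at hsum
          rw [← smul_neg, ← eq_neg_of_add_eq_zero_left hsum, inv_smul_smul₀ (ha i).ne']
        rw [h]
        refine Submodule.neg_mem _ (Submodule.smul_mem _ _ (Submodule.sum_mem _ fun j hj => ?_))
        exact Submodule.smul_mem _ _ (Submodule.subset_span ⟨⟨j, Finset.ne_of_mem_erase hj⟩, rfl⟩)
      · exact Submodule.subset_span ⟨⟨i, hi⟩, rfl⟩
    · apply Submodule.span_mono
      rintro _ ⟨i, rfl⟩
      exact ⟨i, rfl, rfl⟩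
  rw [zon_eq_signFace, setDim, vectorSpan_signFace, hspan, finrank_span_eq_card hli,
    Fintype.card_subtype_compl, Fintype.card_subtype_eq,
    Nat.sub_add_cancel (Fintype.card_pos_iff.2 ⟨k⟩)]

lemma IsPositiveCircuit.setDim_signFace {v : ι → E} (hv : IsPositiveCircuit v)
    {σ : ι → SignType} {k : ι} (hk : σ k ≠ 0) :
    setDim (signFace v σ) + (Finset.univ.filter fun i => σ i ≠ 0).card = Fintype.card ι := by
  have hli := hv.linearIndependent (p := fun i => σ i = 0) hk
  have : setDim (signFace v σ) = Fintype.card {i // σ i = 0} := by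
    rw [setDim, vectorSpan_signFace, ← finrank_span_eq_card hli, Set.image_eq_range]
    rfl
  rw [this, Fintype.card_subtype]
  exact Finset.card_filter_add_card_filter_not _

lemma IsPositiveCircuit.isCubical {v : ι → E} (hv : IsPositiveCircuit v) :
    IsCubical (zon v) := by
  rintro k hk F ⟨hF, hne, hdim⟩
  rcases isExposed_zon_iff.1 hF with rfl | ⟨l, rfl⟩
  · exact absurd hne Set.not_nonempty_empty
  · by_cases h0 : ∃ i, dualSign v l i ≠ 0
    · obtain ⟨i, hi⟩ := h0
      exact isKParallelepiped_signFace (hv.linearIndependent hi) hdim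
    -- The zero sign vector gives the whole zonotope, which is excluded by `k < setDim`.
    · push Not at h0
      have : dualSign v l = 0 := funext h0
      rw [this, ← zon_eq_signFace] at hdim
      exact absurd hdim hk.ne'

section Facets

variable [DecidableEq ι]

lemma IsPositiveCircuit.pairSign_mem {v : ι → E} (hv : IsPositiveCircuit v) {i j : ι}
    (hij : i ≠ j) : pairSign i j ∈ signVectors v := by
  rw [hv.signVectors_eq]
  refine ⟨fun m => if m = i then 1 else if m = j then -1 else 0, ?_, ?_⟩
  · rw [Fintype.sum_eq_add i j hij]
    · simp [hij.symm]
    · rintro m ⟨h1, h2⟩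
      simp [h1, h2]
  · funext m
    by_cases h1 : m = i
    · simp [pairSign, h1]
    · by_cases h2 : m = j
      · subst h2
        simp [pairSign, h1]
      · simp [pairSign, h1, h2]

/-- The zonotope has dimension one less than the number of generators, and a proper face has one
dimension per free coefficient. So codimension one means exactly two nonzero signs, and these are
opposite because they come from a vector of sum zero. -/
lemma IsPositiveCircuit.isFacet_iff {v : ι → E} (hv : IsPositiveCircuit v) {F : Set E} :
    IsFacet (zon v) F ↔ ∃ i j, i ≠ j ∧ F = signFace v (pairSign i j) := by
  constructor
  · rintro ⟨hF, hne, hdim⟩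
    rcases isExposed_zon_iff.1 hF with rfl | ⟨l, rfl⟩
    · exact absurd hne Set.not_nonempty_empty
    obtain ⟨k, hk⟩ : ∃ i, dualSign v l i ≠ 0 := by
      by_contra! h0
      rw [show dualSign v l = 0 from funext h0, ← zon_eq_signFace] at hdim
      omega
    have : Nonempty ι := ⟨k⟩
    have h1 := hv.setDim_signFace hk
    have h2 := hv.setDim_zon
    have h3 : (Finset.univ.filter fun i => dualSign v l i ≠ 0).card = 2 := by omega
    obtain ⟨i, j, hij, hs⟩ := Finset.card_eq_two.1 h3
    have hs' : ∀ m, dualSign v l m ≠ 0 ↔ m = i ∨ m = j := fun m => by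
      have := Finset.ext_iff.1 hs m
      simpa using this
    have hmem : dualSign v l ∈ signVectors v := ⟨l, rfl⟩
    rw [hv.signVectors_eq] at hmem
    obtain ⟨q, hq, hσ⟩ := hmem
    have hz : ∀ m, m ≠ i ∧ m ≠ j → q m = 0 := fun m hm => by
      have : dualSign v l m = 0 := by
        by_contra h
        exact ((hs' m).1 h).elim hm.1 hm.2
      rwa [hσ, sign_eq_zero_iff] at this
    rw [Fintype.sum_eq_add i j hij hz] at hq
    have hi : q i ≠ 0 := fun h => (hs' i).2 (Or.inl rfl) (by rw [hσ]; simp [h])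
    rcases lt_or_gt_of_ne hi with hlt | hgt
    · refine ⟨j, i, hij.symm, ?_⟩
      congr 1
      rw [hσ]
      funext m
      unfold pairSign
      split_ifs with h1 h2
      · rw [h1, sign_pos (by linarith)]
      · rw [h2, sign_neg hlt]
      · rw [hz m ⟨h2, h1⟩, sign_zero]
    · refine ⟨i, j, hij, ?_⟩
      congr 1
      rw [hσ]
      funext m
      unfold pairSign
      split_ifs with h1 h2
      · rw [h1, sign_pos hgt]
      · rw [h2, sign_neg (by linarith)]
      · rw [hz m ⟨h1, h2⟩, sign_zero]
  · rintro ⟨i, j, hij, rfl⟩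
    obtain ⟨l, hl⟩ := hv.pairSign_mem hij
    refine ⟨isExposed_zon_iff.2 (Or.inr ⟨l, by rw [hl]⟩), signFace_nonempty _ _, ?_⟩
    have : Nonempty ι := ⟨i⟩
    have h1 := hv.setDim_signFace (σ := pairSign i j) (k := i) (by simp [pairSign_left])
    have h2 := hv.setDim_zon
    have h3 : (Finset.univ.filter fun m => pairSign i j m ≠ 0) = {i, j} := by
      ext m
      simp [pairSign_ne_zero_iff]
    rw [h3, Finset.card_pair hij] at h1
    omega

lemma IsPositiveCircuit.isFacet_supportFace_iff {v : ι → E} (hv : IsPositiveCircuit v) {p : E} :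
    IsFacet (zon v) (supportFace (zon v) p) ↔
      ∃ i j, i ≠ j ∧ dualSign v (innerSL ℝ p) = pairSign i j := by
  rw [hv.isFacet_iff, supportFace_zon]
  refine exists₂_congr fun i j => and_congr_right fun hij => ⟨fun h => ?_, fun h => by rw [h]⟩
  obtain ⟨l, hl⟩ := hv.pairSign_mem hij
  rw [← hl] at h ⊢
  exact dualSign_eq_of_signFace_eq h

end Facets

end Circuits

/-! ### The Voronoi polytope of the root lattice -/

section RootLattice

variable {n : ℕ}

lemma root_apply (i j m : Fin (n + 1)) :
    (root i j : Space n) m = (if m = i then 1 else 0) - (if m = j then 1 else 0) := by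
  simp [root]

lemma inner_root_right (p : Space n) (i j : Fin (n + 1)) : inner ℝ p (root i j) = p i - p j := by
  simp [root, inner_sub_right, EuclideanSpace.inner_single_right]

lemma inner_root_left (p : Space n) (i j : Fin (n + 1)) : inner ℝ (root i j) p = p i - p j := by
  rw [real_inner_comm, inner_root_right]

lemma sum_root (i j : Fin (n + 1)) : ∑ m, (root i j : Space n) m = 0 := by
  simp [root_apply]

lemma root_self (i : Fin (n + 1)) : (root i i : Space n) = 0 := sub_self _

lemma neg_root (i j : Fin (n + 1)) : -(root i j : Space n) = root j i := neg_sub _ _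

lemma root_add_root (i j k : Fin (n + 1)) : (root i j : Space n) + root j k = root i k :=
  sub_add_sub_cancel _ _ _

lemma mem_rootSystem_iff {t : Space n} : t ∈ rootSystem n ↔ ∃ i j, i ≠ j ∧ t = root i j := by
  constructor
  · rintro ⟨i, j, hij, rfl | rfl⟩
    · exact ⟨i, j, hij.ne, rfl⟩
    · exact ⟨j, i, hij.ne', neg_root i j⟩
  · rintro ⟨i, j, hij, rfl⟩
    rcases lt_or_gt_of_ne hij with h | h
    · exact ⟨i, j, h, Or.inl rfl⟩
    · exact ⟨j, i, h, Or.inr (neg_root j i).symm⟩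

lemma root_mem_rootLattice (i j : Fin (n + 1)) : (root i j : Space n) ∈ rootLattice n := by
  by_cases hij : i = j
  · rw [hij, root_self]
    exact Submodule.zero_mem _
  · exact Submodule.subset_span (mem_rootSystem_iff.2 ⟨i, j, hij, rfl⟩)

lemma exists_int_of_mem_rootLattice {x : Space n} (hx : x ∈ rootLattice n) :
    ∃ z : Fin (n + 1) → ℤ, ∀ i, x i = (z i : ℝ) := by
  induction hx using Submodule.span_induction with
  | mem x hx =>
    obtain ⟨i, j, -, rfl⟩ := mem_rootSystem_iff.1 hx
    exact ⟨fun m => (if m = i then 1 else 0) - (if m = j then 1 else 0), fun m => by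
      simp [root_apply]⟩
  | zero => exact ⟨0, fun _ => by simp⟩
  | add x y _ _ hx hy =>
    obtain ⟨z, hz⟩ := hx
    obtain ⟨w, hw⟩ := hy
    exact ⟨z + w, fun m => by simp [hz, hw]⟩
  | smul a x _ hx =>
    obtain ⟨z, hz⟩ := hx
    exact ⟨a • z, fun m => by simp [hz]⟩

lemma eq_sum_smul_root {x : Space n} (hx : ∑ i, x i = 0) (j : Fin (n + 1)) :
    x = ∑ i, x i • root i j := by
  ext m
  simp [root_apply, mul_sub, Finset.sum_sub_distrib, hx]

lemma mem_span_rootLattice_iff {x : Space n} :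
    x ∈ Submodule.span ℝ (rootLattice n : Set (Space n)) ↔ ∑ i, x i = 0 := by
  constructor
  · intro h
    induction h using Submodule.span_induction with
    | mem x hx =>
      induction hx using Submodule.span_induction with
      | mem x hx =>
        obtain ⟨i, j, -, rfl⟩ := mem_rootSystem_iff.1 hx
        exact sum_root i j
      | zero => simp
      | add x y _ _ hx hy => simp [Finset.sum_add_distrib, hx, hy]
      | smul a x _ hx => simp [← Finset.mul_sum, hx]
    | zero => simp
    | add x y _ _ hx hy => simp [Finset.sum_add_distrib, hx, hy]
    | smul a x _ hx => simp [← Finset.mul_sum, hx]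
  · intro h
    rw [eq_sum_smul_root h 0]
    exact Submodule.sum_mem _ fun i _ =>
      Submodule.smul_mem _ _ (Submodule.subset_span (root_mem_rootLattice i 0))

lemma sum_eq_zero_of_mem_rootLattice {x : Space n} (hx : x ∈ rootLattice n) : ∑ i, x i = 0 :=
  mem_span_rootLattice_iff.1 (Submodule.subset_span hx)

/-- Half of the projection of `eₖ` to the hyperplane `∑ xᵢ = 0`. -/
def halfProj (n : ℕ) (k : Fin (n + 1)) : Space n :=
  WithLp.toLp 2 fun m => ((if m = k then 1 else 0) - 1 / (n + 1 : ℝ)) / 2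

lemma halfProj_apply (k m : Fin (n + 1)) :
    halfProj n k m = ((if m = k then 1 else 0) - 1 / (n + 1 : ℝ)) / 2 := rfl

lemma inner_halfProj (p : Space n) (k : Fin (n + 1)) :
    inner ℝ p (halfProj n k) = (p k - (∑ i, p i) / (n + 1)) / 2 := by
  simp only [PiLp.inner_apply, halfProj_apply, RCLike.inner_apply, conj_trivial]
  simp only [div_mul_eq_mul_div, ← Finset.sum_div, sub_mul, Finset.sum_sub_distrib, ite_mul,
    one_mul, zero_mul, Finset.sum_ite_eq', Finset.mem_univ, if_true]

lemma isPositiveCircuit_halfProj (n : ℕ) : IsPositiveCircuit (halfProj n) := by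
  refine ⟨fun _ => 1, fun _ => one_pos, ?_, fun q hq => ?_⟩
  · ext m
    have : (n + 1 : ℝ) ≠ 0 := by positivity
    simp [halfProj_apply, ← Finset.sum_div, Finset.sum_sub_distrib, this]
  -- By `inner_halfProj` a vector of sum zero pairs with the k-th generator to half its k-th
  -- coordinate, hence the factor 2.
  · refine ⟨innerSL ℝ (WithLp.toLp 2 fun i => 2 * q i), fun k => ?_⟩
    simp only [one_mul] at hq
    rw [innerSL_apply_apply, inner_halfProj]
    simp [← Finset.mul_sum, hq]

lemma norm_le_norm_sub_iff {F : Type*} [NormedAddCommGroup F] [InnerProductSpace ℝ F] (x v : F) :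
    ‖x‖ ≤ ‖x - v‖ ↔ inner ℝ v x ≤ inner ℝ v v / 2 := by
  rw [← sq_le_sq₀ (norm_nonneg _) (norm_nonneg _), norm_sub_sq_real, real_inner_self_eq_norm_sq,
    real_inner_comm]
  constructor <;> intro h <;> linarith

lemma inner_root_self {i j : Fin (n + 1)} (hij : i ≠ j) :
    inner ℝ (root i j : Space n) (root i j) = 2 := by
  rw [inner_root_left, root_apply, root_apply]
  simp [hij, hij.symm]
  norm_num

lemma mem_voronoiPolytope_iff {x : Space n} :
    x ∈ voronoiPolytope (rootLattice n) ↔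
      ∑ i, x i = 0 ∧ ∀ v ∈ rootLattice n, inner ℝ v x ≤ inner ℝ v v / 2 := by
  simp only [voronoiPolytope, Set.mem_ofPred_eq, mem_span_rootLattice_iff, norm_le_norm_sub_iff]

/-- The inequalities of the roots alone bound the differences of coordinates by 1, and this already
gives coefficients in [-1, 1]. Conversely, the inequality of any lattice vector holds on the
zonotope because |z| ≤ z² for integers. -/
lemma voronoiPolytope_rootLattice (n : ℕ) :
    voronoiPolytope (rootLattice n) = zon (halfProj n) := by
  ext x
  rw [mem_voronoiPolytope_iff]
  constructor
  · rintro ⟨hx, hv⟩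
    obtain ⟨k, -, hk⟩ := Finset.exists_min_image Finset.univ x ⟨0, Finset.mem_univ _⟩
    have hd : ∀ i, x i - x k ≤ 1 := fun i => by
      by_cases hik : i = k
      · simp [hik]
      · have := hv _ (root_mem_rootLattice i k)
        rwa [inner_root_left, inner_root_self hik, div_self two_ne_zero] at this
    -- The coefficients `2 * x i` represent `x`. A common shift is free since the generators sum to
    -- zero; this one puts the smallest coefficient at -1.
    refine ⟨fun i => 2 * (x i - x k) - 1, fun i => ?_, ?_⟩
    · have h1 := hd i
      have h2 := hk i (Finset.mem_univ i)
      rw [abs_le]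
      constructor <;> linarith
    · ext m
      have h0 : (n + 1 : ℝ) ≠ 0 := by positivity
      simp only [WithLp.ofLp_sum, WithLp.ofLp_smul, Finset.sum_apply, Pi.smul_apply, smul_eq_mul,
        halfProj_apply, mul_div_assoc', ← Finset.sum_div, mul_sub, Finset.sum_sub_distrib, mul_ite,
        mul_one, mul_zero, Finset.sum_ite_eq, Finset.mem_univ, if_true, ← Finset.mul_sum,
        hx]
      simp
      field_simp
      ring
  · rintro ⟨c, hc, rfl⟩
    constructor
    · rw [← mem_span_rootLattice_iff]
      refine Submodule.sum_mem _ fun i _ => Submodule.smul_mem _ _ ?_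
      rw [mem_span_rootLattice_iff]
      have : (n + 1 : ℝ) ≠ 0 := by positivity
      simp [halfProj_apply, ← Finset.sum_div, Finset.sum_sub_distrib, this]
    · intro v hv
      obtain ⟨z, hz⟩ := exists_int_of_mem_rootLattice hv
      rw [inner_sum]
      simp only [inner_smul_right, inner_halfProj, sum_eq_zero_of_mem_rootLattice hv, zero_div,
        sub_zero]
      rw [PiLp.inner_apply, Finset.sum_div]
      refine Finset.sum_le_sum fun i _ => ?_
      rw [mul_div_assoc']
      refine div_le_div_of_nonneg_right ((mul_le_abs_of_abs_le_one (hc i)).trans ?_) zero_le_two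
      rw [hz, RCLike.inner_apply, conj_trivial, ← Int.cast_abs, ← Int.cast_mul, Int.cast_le,
        ← abs_mul_abs_self]
      rcases eq_or_ne (z i) 0 with h | h
      · simp [h]
      · nlinarith [Int.one_le_abs h]

lemma dualSign_halfProj {p : Space n} (hp : ∑ i, p i = 0) :
    dualSign (halfProj n) (innerSL ℝ p) = fun i => SignType.sign (p i) := by
  funext i
  rw [dualSign, innerSL_apply_apply, inner_halfProj, hp, zero_div, sub_zero, div_eq_inv_mul,
    sign_mul_of_pos (by norm_num)]

lemma supportSet_eq_supportFace {P : Set (Space n)} {v x : Space n} {r : ℝ}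
    (hP : ∀ x ∈ P, inner ℝ v x ≤ r) (hx : x ∈ P) (hxr : inner ℝ v x = r) :
    {x ∈ P | inner ℝ v x = r} = supportFace P v := by
  ext y
  constructor
  · rintro ⟨hy, h⟩
    exact ⟨hy, fun z hz => (hP z hz).trans_eq h.symm⟩
  · rintro ⟨hy, h⟩
    exact ⟨hy, le_antisymm (hP y hy) (hxr.symm.trans_le (h x hx))⟩

lemma half_root_mem_voronoiPolytope (i j : Fin (n + 1)) :
    (1 / 2 : ℝ) • root i j ∈ voronoiPolytope (rootLattice n) := by
  rw [voronoiPolytope_rootLattice]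
  refine ⟨fun m => (if m = i then 1 else 0) - (if m = j then 1 else 0), fun m => ?_, ?_⟩
  · dsimp only
    split_ifs <;> simp
  · ext m
    simp only [WithLp.ofLp_sum, WithLp.ofLp_smul, Finset.sum_apply, Pi.smul_apply, smul_eq_mul,
      halfProj_apply, root_apply, sub_mul, ite_mul, one_mul, zero_mul, Finset.sum_sub_distrib,
      Finset.sum_ite_eq', Finset.mem_univ, if_true]
    ring

/-- The facet sign pattern makes `v` a positive multiple s of a root. On the polytope the functional
of `v` is at most s by the inequality of the root, while the bisecting hyperplane needs the value
s². So s ≤ 1, and integrality gives s = 1. -/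
lemma voronoiFacetVectors_rootLattice (n : ℕ) :
    voronoiFacetVectors (rootLattice n) = rootSystem n := by
  have hc := isPositiveCircuit_halfProj n
  have hP : ∀ v ∈ rootLattice n, ∀ x ∈ voronoiPolytope (rootLattice n),
      inner ℝ v x ≤ inner ℝ v v / 2 := fun v hv x hx => (mem_voronoiPolytope_iff.1 hx).2 v hv
  have hval : ∀ i j : Fin (n + 1), inner ℝ (root i j) ((1 / 2 : ℝ) • root i j) =
      inner ℝ (root i j : Space n) (root i j) / 2 := fun i j => by
    rw [inner_smul_right]
    ring
  ext v
  rw [mem_rootSystem_iff]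
  constructor
  · rintro ⟨hv, hF⟩
    obtain ⟨x, hx, hxv⟩ := hF.2.1
    rw [supportSet_eq_supportFace (hP v hv) hx hxv, voronoiPolytope_rootLattice,
      hc.isFacet_supportFace_iff] at hF
    have hv0 := sum_eq_zero_of_mem_rootLattice hv
    obtain ⟨i, j, hij, h⟩ := hF
    rw [dualSign_halfProj hv0] at h
    have hpos : 0 < v i := by
      rw [← sign_eq_one_iff]
      exact (congrFun h i).trans (pairSign_left i j)
    have hz : ∀ m, m ≠ i ∧ m ≠ j → v m = 0 := fun m hm => by
      rw [← sign_eq_zero_iff]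
      exact (congrFun h m).trans (by simp [pairSign, hm.1, hm.2])
    have hvij : v = v i • root i j := by
      rw [Fintype.sum_eq_add i j hij hz] at hv0
      ext m
      simp only [PiLp.smul_apply, root_apply, smul_eq_mul]
      by_cases hi : m = i
      · subst hi
        simp [hij]
      · by_cases hj : m = j
        · subst hj
          simp [hi]
          linarith
        · simp [hi, hj, hz m ⟨hi, hj⟩]
    have hsup : inner ℝ v x ≤ v i := by
      have := hP _ (root_mem_rootLattice i j) x hx
      rw [inner_root_self hij, div_self two_ne_zero] at this
      rw [hvij, inner_smul_left, ← hvij]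
      simpa using mul_le_mul_of_nonneg_left this hpos.le
    have hvv : inner ℝ v v / 2 = v i * v i := by
      conv_lhs => rw [hvij, inner_smul_left, inner_smul_right, inner_root_self hij]
      rw [conj_trivial]
      ring
    rw [hxv, hvv] at hsup
    obtain ⟨z, hz⟩ := exists_int_of_mem_rootLattice hv
    have h1 : v i ≤ 1 := by
      by_contra! h
      nlinarith
    have h2 : v i = 1 := by
      have h3 : (z i : ℝ) ≤ 1 := (hz i).symm.trans_le h1
      have h4 : (0 : ℝ) < z i := hpos.trans_eq (hz i)
      norm_cast at h3 h4
      rw [hz, show z i = 1 by omega, Int.cast_one]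
    exact ⟨i, j, hij, by rw [hvij, h2, one_smul]⟩
  · rintro ⟨i, j, hij, rfl⟩
    refine ⟨root_mem_rootLattice i j, ?_⟩
    rw [supportSet_eq_supportFace (hP _ (root_mem_rootLattice i j))
      (half_root_mem_voronoiPolytope i j) (hval i j),
      voronoiPolytope_rootLattice, hc.isFacet_supportFace_iff]
    refine ⟨i, j, hij, ?_⟩
    rw [dualSign_halfProj (sum_root i j)]
    funext m
    rw [root_apply]
    by_cases hi : m = i
    · subst hi
      simp [pairSign, hij]
    · by_cases hj : m = j
      · subst hj
        simp [pairSign, hi]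
      · simp [pairSign, hi, hj]

end RootLattice

/-! ### Unimodularity of the root system -/

section Unimodular

variable {n : ℕ}

/-- Viewed as edges of a graph, a spanning set of roots connects all vertices. Let K be the set of
`k` with `root i k` in the integer span. A root in `B` has both ends in K or neither, so the
functional summing the coordinates over K kills `B`, hence every root; but it is 1 on `root i j` if
`j` is outside K. -/
lemma root_mem_span_int_of_span_eq {B : Set (Space n)} (hB : B ⊆ rootSystem n)
    (hspan : Submodule.span ℝ B = Submodule.span ℝ (rootSystem n)) {x : Space n}
    (hx : x ∈ rootSystem n) : x ∈ Submodule.span ℤ B := by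
  classical
  obtain ⟨i, j, hij, rfl⟩ := mem_rootSystem_iff.1 hx
  by_contra hnot
  let f : Space n →ₗ[ℝ] ℝ :=
    ∑ k : Fin (n + 1), if root i k ∈ Submodule.span ℤ B then
      (LinearMap.proj k).comp (WithLp.linearEquiv 2 ℝ (Fin (n + 1) → ℝ)).toLinearMap else 0
  have hf : ∀ a c, f (root a c) = (if root i a ∈ Submodule.span ℤ B then 1 else 0) -
      (if root i c ∈ Submodule.span ℤ B then 1 else 0) := by
    intro a c
    have : ∀ k, (if root i k ∈ Submodule.span ℤ B then
        (LinearMap.proj k).comp (WithLp.linearEquiv 2 ℝ (Fin (n + 1) → ℝ)).toLinearMap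
        else 0 : Space n →ₗ[ℝ] ℝ) (root a c) =
        if root i k ∈ Submodule.span ℤ B then (root a c : Space n) k else 0 := by
      intro k
      split_ifs <;> simp
    simp only [f, LinearMap.sum_apply, this, root_apply]
    rw [← Finset.sum_filter]
    simp only [Finset.sum_sub_distrib, Finset.sum_ite_eq', Finset.mem_filter, Finset.mem_univ,
      true_and]
  have hker : Submodule.span ℝ B ≤ LinearMap.ker f := by
    rw [Submodule.span_le]
    intro t ht
    obtain ⟨a, c, -, rfl⟩ := mem_rootSystem_iff.1 (hB ht)
    have hac : root a c ∈ Submodule.span ℤ B := Submodule.subset_span ht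
    have : root i a ∈ Submodule.span ℤ B ↔ root i c ∈ Submodule.span ℤ B := by
      rw [← root_add_root i a c]
      exact (Submodule.add_mem_iff_left _ hac).symm
    rw [SetLike.mem_coe, LinearMap.mem_ker, hf]
    simp [this]
  have h := hker (hspan ▸ Submodule.subset_span hx)
  rw [LinearMap.mem_ker, hf, if_neg hnot, if_pos (by rw [root_self]; exact Submodule.zero_mem _)]
    at h
  norm_num at h

lemma isUnimodularSet_image_rootSystem (T : Space n ≃ₗ[ℝ] Space n) :
    IsUnimodularSet (T '' rootSystem n) := by
  intro B hB _ hspan x hx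
  obtain ⟨t, ht, rfl⟩ := hx
  have hTB : T '' (T ⁻¹' B) = B := Set.image_preimage_eq B T.surjective
  have h1 : T ⁻¹' B ⊆ rootSystem n := fun y hy => by
    obtain ⟨z, hz, hzy⟩ := hB hy
    rwa [← T.injective hzy]
  have h2 : Submodule.span ℝ (T ⁻¹' B) = Submodule.span ℝ (rootSystem n) := by
    apply Submodule.map_injective_of_injective (f := T.toLinearMap) T.injective
    rw [Submodule.map_span, Submodule.map_span]
    change Submodule.span ℝ (T '' (T ⁻¹' B)) = Submodule.span ℝ (T '' rootSystem n)
    rw [hTB, hspan]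
  have h3 := root_mem_span_int_of_span_eq h1 h2 ht
  have h4 := Submodule.mem_map_of_mem (f := (T.toLinearMap.restrictScalars ℤ)) h3
  rw [Submodule.map_span] at h4
  change T t ∈ Submodule.span ℤ (T '' (T ⁻¹' B)) at h4
  rwa [hTB] at h4

end Unimodular

/-! ### Parametrized Hamiltonian circuits -/

section Circuit

variable {n : ℕ}

/-- `φ` runs through the circuit `C`, starting at the vertex `0`. -/
structure IsCircuitParam (C : SimpleGraph (Fin (n + 1))) (φ : Fin (n + 1) ≃ Fin (n + 1)) :
    Prop where
  two_le : 2 ≤ n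
  map_zero : φ 0 = 0
  adj_iff : ∀ a b, C.Adj (φ a) (φ b) ↔ b = a + 1 ∨ a = b + 1

lemma IsHamiltonianCircuit.exists_param {C : SimpleGraph (Fin (n + 1))}
    (hC : IsHamiltonianCircuit C) : ∃ φ, IsCircuitParam C φ := by
  obtain ⟨hn, ⟨e⟩⟩ := hC
  obtain ⟨m, rfl⟩ : ∃ m, n = m + 1 := ⟨n - 1, by omega⟩
  -- A rotation of the standard cycle moves the starting point to the vertex 0.
  refine ⟨(Equiv.addRight (e.symm 0)).trans e.toEquiv, hn, by simp, fun a b => ?_⟩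
  have h : C.Adj (e (a + e.symm 0)) (e (b + e.symm 0)) ↔ b = a + 1 ∨ a = b + 1 := by
    rw [e.map_adj_iff, SimpleGraph.cycleGraph_adj, add_sub_add_right_eq_sub,
      add_sub_add_right_eq_sub, sub_eq_iff_eq_add', sub_eq_iff_eq_add', or_comm]
  exact h

/-- This prevents the circuit from running back along an edge, so distinct positions `m` give
distinct edges. -/
lemma two_ne_zero_of_two_le (hn : 2 ≤ n) : (1 + 1 : Fin (n + 1)) ≠ 0 := by
  obtain ⟨m, rfl⟩ : ∃ m, n = m + 2 := ⟨n - 2, by omega⟩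
  simp [Fin.ext_iff, Fin.val_add, Nat.mod_eq_of_lt]

lemma ne_add_one_of_two_le (hn : 2 ≤ n) (m : Fin (n + 1)) : m ≠ m + 1 := by
  obtain ⟨m, rfl⟩ : ∃ m, n = m + 1 := ⟨n - 1, by omega⟩
  simp

lemma mem_edgePairs {G : SimpleGraph (Fin (n + 1))} {u : Fin (n + 1) × Fin (n + 1)} :
    u ∈ edgePairs G ↔ u.1 < u.2 ∧ G.Adj u.1 u.2 := by
  simp [edgePairs]

lemma IsCircuitParam.sum_edgePairs {C : SimpleGraph (Fin (n + 1))}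
    {φ : Fin (n + 1) ≃ Fin (n + 1)} (hφ : IsCircuitParam C φ) {M : Type*} [AddCommMonoid M]
    (f : Fin (n + 1) → Fin (n + 1) → M) (hf : ∀ a b, f a b = f b a) :
    ∑ u ∈ edgePairs C, f u.1 u.2 = ∑ m, f (φ m) (φ (m + 1)) := by
  symm
  have hadj : ∀ m, C.Adj (φ m) (φ (m + 1)) := fun m => (hφ.adj_iff _ _).2 (Or.inl rfl)
  refine Finset.sum_bij
    (fun m _ => if φ m < φ (m + 1) then (φ m, φ (m + 1)) else (φ (m + 1), φ m)) ?_ ?_ ?_ ?_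
  · intro m _
    rw [mem_edgePairs]
    split_ifs with h
    · exact ⟨h, hadj m⟩
    · exact ⟨lt_of_le_of_ne (not_lt.1 h) (hadj m).ne', (hadj m).symm⟩
  · intro a _ b _ h
    have key : (a = b ∧ a + 1 = b + 1) ∨ (a = b + 1 ∧ a + 1 = b) := by
      split_ifs at h <;> simp only [Prod.mk.injEq, φ.injective.eq_iff] at h <;> tauto
    rcases key with h | ⟨h1, h2⟩
    · exact h.1
    · rw [h1, add_assoc, add_eq_left] at h2
      exact absurd h2 (two_ne_zero_of_two_le hφ.two_le)
  · rintro ⟨a, b⟩ hab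
    rw [mem_edgePairs] at hab
    obtain ⟨x, rfl⟩ := φ.surjective a
    obtain ⟨y, rfl⟩ := φ.surjective b
    obtain ⟨hlt, hadj⟩ := hab
    rcases (hφ.adj_iff x y).1 hadj with rfl | rfl
    · exact ⟨x, Finset.mem_univ _, if_pos hlt⟩
    · exact ⟨y, Finset.mem_univ _, if_neg (not_lt.2 (le_of_lt hlt))⟩
  · intro m _
    split_ifs
    · rfl
    · exact hf _ _

/-- The weighted edge vectors of a circuit, in cyclic order. -/
def circuitVec (φ : Fin (n + 1) ≃ Fin (n + 1)) (b : Sym2 (Fin (n + 1)) → ℝ) (m : Fin (n + 1)) :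
    Space n :=
  b s(φ m, φ (m + 1)) • root (φ m) (φ (m + 1))

lemma smul_zSegment (c : ℝ) (t : Space n) :
    c • zSegment t = {x | ∃ d : ℝ, |d| ≤ 1 ∧ d • c • t = x} := by
  ext x
  constructor
  · rintro ⟨_, ⟨d, h1, h2, rfl⟩, rfl⟩
    exact ⟨d, abs_le.2 ⟨h1, h2⟩, smul_comm _ _ _⟩
  · rintro ⟨d, hd, rfl⟩
    exact ⟨d • t, ⟨d, (abs_le.1 hd).1, (abs_le.1 hd).2, rfl⟩, smul_comm _ _ _⟩

lemma sum_segment_eq_zon {ι E : Type*} [Fintype ι] [DecidableEq ι] [NormedAddCommGroup E]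
    [InnerProductSpace ℝ E] (s : Finset ι) (v : ι → E) :
    ∑ i ∈ s, {x | ∃ d : ℝ, |d| ≤ 1 ∧ d • v i = x} = zon fun i => if i ∈ s then v i else 0 := by
  ext x
  rw [Set.mem_finsetSum]
  have hsum : ∀ c : ι → ℝ, ∑ i, c i • (if i ∈ s then v i else 0) = ∑ i ∈ s, c i • v i := by
    intro c
    simp only [smul_ite, smul_zero, Finset.sum_ite_mem, Finset.univ_inter]
  constructor
  · rintro ⟨g, hg, rfl⟩
    have hg' : ∀ i, i ∈ s → ∃ d : ℝ, |d| ≤ 1 ∧ d • v i = g i := fun i hi => hg hi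
    choose! c hc1 hc2 using hg'
    refine ⟨fun i => if i ∈ s then c i else 0, fun i => ?_, ?_⟩
    · dsimp only
      split_ifs with h
      · exact hc1 i h
      · simp
    · rw [hsum]
      refine Finset.sum_congr rfl fun i hi => ?_
      rw [if_pos hi, hc2 i hi]
  · rintro ⟨c, hc, rfl⟩
    exact ⟨fun i => c i • v i, fun {i} _ => ⟨c i, hc i, rfl⟩, (hsum c).symm⟩

lemma zonotope_eq_zon (G : SimpleGraph (Fin (n + 1))) (b : Sym2 (Fin (n + 1)) → ℝ) :
    zonotope G b = zon fun u : Fin (n + 1) × Fin (n + 1) =>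
      if u ∈ edgePairs G then b s(u.1, u.2) • root u.1 u.2 else 0 := by
  classical
  rw [zonotope, ← sum_segment_eq_zon]
  exact Finset.sum_congr rfl fun u _ => smul_zSegment _ _

lemma IsCircuitParam.zonotope_eq {C : SimpleGraph (Fin (n + 1))}
    {φ : Fin (n + 1) ≃ Fin (n + 1)} (hφ : IsCircuitParam C φ) (b : Sym2 (Fin (n + 1)) → ℝ) :
    zonotope C b = zon (circuitVec φ b) := by
  rw [zonotope, hφ.sum_edgePairs (fun i j => b s(i, j) • zSegment (root i j))]
  · simp only [smul_zSegment]
    have := sum_segment_eq_zon Finset.univ (circuitVec φ b)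
    simp only [Finset.mem_univ, if_true] at this
    exact this
  · intro i j
    rw [Sym2.eq_swap, smul_zSegment, smul_zSegment, ← neg_root i j]
    ext x
    constructor <;> rintro ⟨d, hd, rfl⟩ <;> exact ⟨-d, by rwa [abs_neg], by simp⟩

/-- Tail sums along the circuit. -/
def tailSum (φ : Fin (n + 1) ≃ Fin (n + 1)) : Space n →ₗ[ℝ] Space n where
  toFun r := WithLp.toLp 2 fun a => ∑ m ∈ Finset.Ici (φ.symm a), r m
  map_add' r s := by
    ext a
    simp [Finset.sum_add_distrib]
  map_smul' c r := by
    ext a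
    simp [Finset.mul_sum]

lemma tailSum_apply (φ : Fin (n + 1) ≃ Fin (n + 1)) (r : Space n) (k : Fin (n + 1)) :
    tailSum φ r (φ k) = ∑ m ∈ Finset.Ici k, r m := by
  simp [tailSum]

lemma sum_Ici_castSucc {M : Type*} [AddCommMonoid M] (r : Fin (n + 1) → M) (k : Fin n) :
    ∑ m ∈ Finset.Ici k.castSucc, r m = r k.castSucc + ∑ m ∈ Finset.Ici k.succ, r m := by
  have : Finset.Ici k.castSucc = insert k.castSucc (Finset.Ici k.succ) := by
    ext m
    simp only [Finset.mem_Ici, Finset.mem_insert, Fin.ext_iff, Fin.le_def, Fin.val_castSucc,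
      Fin.val_succ]
    omega
  rw [this, Finset.sum_insert]
  simp

lemma Ici_last : Finset.Ici (Fin.last n) = {Fin.last n} := by
  ext m
  simp

/-- Consecutive tails differ by one term. The hypothesis of sum zero serves the closing step from
the last position back to 0, where the tail is the full sum. -/
lemma tailSum_sub {φ : Fin (n + 1) ≃ Fin (n + 1)} {r : Space n} (hr : ∑ m, r m = 0)
    (m : Fin (n + 1)) : tailSum φ r (φ m) - tailSum φ r (φ (m + 1)) = r m := by
  rw [tailSum_apply, tailSum_apply]
  induction m using Fin.lastCases with
  | last =>
    have h0 : Finset.Ici (0 : Fin (n + 1)) = Finset.univ := by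
      ext
      simp
    rw [Fin.last_add_one, h0, hr, Ici_last]
    simp
  | cast k =>
    rw [sum_Ici_castSucc, Fin.coeSucc_eq_succ]
    simp

/-- Differences along the circuit determine a vector up to a constant, and the value 0 at the
starting vertex fixes the constant. -/
lemma eq_tailSum {φ : Fin (n + 1) ≃ Fin (n + 1)} {r p : Space n} (hr : ∑ m, r m = 0)
    (h0 : p (φ 0) = 0) (hp : ∀ m, p (φ m) - p (φ (m + 1)) = r m) : p = tailSum φ r := by
  have key : ∀ k, p (φ k) = tailSum φ r (φ k) := by
    intro k
    induction k using Fin.induction with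
    | zero =>
      rw [h0, tailSum_apply, ← hr]
      refine (Finset.sum_congr ?_ fun _ _ => rfl).symm
      ext
      simp
    | succ k ih =>
      have h1 := hp k.castSucc
      have h2 := tailSum_sub (φ := φ) hr k.castSucc
      rw [Fin.coeSucc_eq_succ] at h1 h2
      linarith
  ext a
  obtain ⟨k, rfl⟩ := φ.surjective a
  exact key k

/-- Tail sums are triangular, so injectivity holds on all of `Space n` and not only on the
hyperplane; `LinearlyEquivalent` asks for a map of the whole space. -/
lemma tailSum_injective (φ : Fin (n + 1) ≃ Fin (n + 1)) : Function.Injective (tailSum φ) := by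
  rw [← LinearMap.ker_eq_bot, LinearMap.ker_eq_bot']
  intro r hr
  have h : ∀ k, ∑ m ∈ Finset.Ici k, r m = 0 := fun k => by rw [← tailSum_apply φ, hr]; simp
  ext k
  induction k using Fin.lastCases with
  | last => simpa [Ici_last] using h (Fin.last n)
  | cast k =>
    have := sum_Ici_castSucc r k
    rw [h, h] at this
    simpa using this.symm

/-- Tail sums along the circuit, as an invertible linear map. -/
def tailSumEquiv (φ : Fin (n + 1) ≃ Fin (n + 1)) : Space n ≃ₗ[ℝ] Space n :=
  LinearEquiv.ofInjectiveEndo (tailSum φ) (tailSum_injective φ)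

lemma IsCircuitParam.weight_pos {C : SimpleGraph (Fin (n + 1))}
    {φ : Fin (n + 1) ≃ Fin (n + 1)} (hφ : IsCircuitParam C φ) {b : Sym2 (Fin (n + 1)) → ℝ}
    (hb : ∀ e ∈ C.edgeSet, 0 < b e) (m : Fin (n + 1)) : 0 < b s(φ m, φ (m + 1)) :=
  hb _ ((hφ.adj_iff _ _).2 (Or.inl rfl))

/-- With the weights divided out, the edge vectors telescope around the circuit, which is the
relation. Tail sums provide a functional with any admissible values. -/
lemma isPositiveCircuit_circuitVec {φ : Fin (n + 1) ≃ Fin (n + 1)} {b : Sym2 (Fin (n + 1)) → ℝ}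
    (hb : ∀ m, 0 < b s(φ m, φ (m + 1))) : IsPositiveCircuit (circuitVec φ b) := by
  refine ⟨fun m => (b s(φ m, φ (m + 1)))⁻¹, fun m => inv_pos.2 (hb m), ?_, fun q hq => ?_⟩
  · simp only [circuitVec, inv_smul_smul₀ (hb _).ne', root, Finset.sum_sub_distrib]
    rw [sub_eq_zero]
    exact (Equiv.sum_comp (Equiv.addRight 1)
      fun m => (EuclideanSpace.single (φ m) 1 : Space n)).symm
  · refine ⟨innerSL ℝ (tailSum φ (WithLp.toLp 2 fun m => (b s(φ m, φ (m + 1)))⁻¹ * q m)),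
      fun m => ?_⟩
    rw [innerSL_apply_apply, circuitVec, inner_smul_right, inner_root_right, tailSum_sub hq]
    exact mul_inv_cancel_left₀ (hb m).ne' _

lemma dualSign_circuitVec {φ : Fin (n + 1) ≃ Fin (n + 1)} {b : Sym2 (Fin (n + 1)) → ℝ}
    (hb : ∀ m, 0 < b s(φ m, φ (m + 1))) (p : Space n) :
    dualSign (circuitVec φ b) (innerSL ℝ p) =
      fun m => SignType.sign (p (φ m) - p (φ (m + 1))) := by
  funext m
  rw [dualSign, innerSL_apply_apply, circuitVec, inner_smul_right, inner_root_right,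
    sign_mul_of_pos (hb m)]

lemma pairSign_cast {i j : Fin (n + 1)} (hij : i ≠ j) (m : Fin (n + 1)) :
    ((pairSign i j m : SignType) : ℝ) = (root i j : Space n) m := by
  rw [root_apply]
  by_cases hi : m = i
  · subst hi
    simp [pairSign, hij]
  · by_cases hj : m = j
    · subst hj
      simp [pairSign, hi]
    · simp [pairSign, hi, hj]

lemma sign_root_apply {i j : Fin (n + 1)} (hij : i ≠ j) :
    (fun m => SignType.sign ((root i j : Space n) m)) = pairSign i j := by
  funext m
  rw [← pairSign_cast hij]
  cases pairSign i j m <;> simp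

lemma root_eq_of_pairSign_eq {i j i' j' : Fin (n + 1)} (hij : i ≠ j) (hij' : i' ≠ j')
    (h : pairSign i j = pairSign i' j') : (root i j : Space n) = root i' j' := by
  ext m
  rw [← pairSign_cast hij, ← pairSign_cast hij', h]

lemma root_eq_root_iff {i j i' j' : Fin (n + 1)} (hij : i ≠ j) :
    (root i j : Space n) = root i' j' ↔ i = i' ∧ j = j' := by
  constructor
  · intro h
    have h1 := congrArg (fun x : Space n => x i) h
    have h2 := congrArg (fun x : Space n => x j) h
    simp only [root_apply, hij, hij.symm, if_true, if_false] at h1 h2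
    split_ifs at h1 h2 with h3 h4 h5 h6 <;> first | linarith | grind
  · rintro ⟨rfl, rfl⟩
    rfl

lemma dualSign_tailSum_root {φ : Fin (n + 1) ≃ Fin (n + 1)} {b : Sym2 (Fin (n + 1)) → ℝ}
    (hb : ∀ m, 0 < b s(φ m, φ (m + 1))) {i j : Fin (n + 1)} (hij : i ≠ j) :
    dualSign (circuitVec φ b) (innerSL ℝ (tailSum φ (root i j))) = pairSign i j := by
  rw [dualSign_circuitVec hb, ← sign_root_apply hij]
  funext m
  rw [tailSum_sub (sum_root i j)]

/-- The vertices of the circuit from position `i + 1` to position `j`. -/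
def arc (φ : Fin (n + 1) ≃ Fin (n + 1)) (i j : Fin (n + 1)) : Finset (Fin (n + 1)) :=
  (Finset.Ioc i j).map φ.toEmbedding

lemma mem_arc {φ : Fin (n + 1) ≃ Fin (n + 1)} {i j k : Fin (n + 1)} :
    φ k ∈ arc φ i j ↔ i < k ∧ k ≤ j := by
  simp [arc]

lemma incidenceVector_apply (S : Finset (Fin (n + 1))) (k : Fin (n + 1)) :
    incidenceVector S k = if k ∈ S then 1 else 0 := by
  simp [incidenceVector, Pi.single_apply]

lemma tailSum_root {φ : Fin (n + 1) ≃ Fin (n + 1)} {i j : Fin (n + 1)} (hij : i < j) :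
    tailSum φ (root j i) = incidenceVector (arc φ i j) := by
  ext a
  obtain ⟨k, rfl⟩ := φ.surjective a
  rw [tailSum_apply, incidenceVector_apply]
  simp only [mem_arc, root_apply, Finset.sum_sub_distrib, Finset.sum_ite_eq', Finset.mem_Ici]
  by_cases h1 : k ≤ i
  · simp [h1, h1.trans hij.le, not_lt.2 h1]
  · simp [h1, not_le.1 h1]

lemma zero_notMem_arc {φ : Fin (n + 1) ≃ Fin (n + 1)} (h0 : φ 0 = 0) (i j : Fin (n + 1)) :
    0 ∉ arc φ i j := by
  have := mem_arc (φ := φ) (i := i) (j := j) (k := 0)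
  rw [h0] at this
  simp [this]

lemma arc_nonempty {φ : Fin (n + 1) ≃ Fin (n + 1)} {i j : Fin (n + 1)} (hij : i < j) :
    (arc φ i j).Nonempty :=
  ⟨φ j, mem_arc.2 ⟨hij, le_rfl⟩⟩

/-- The differences of a vector ±e_S along the circuit lie in {-1, 0, 1}, so they equal their own
signs. The facet pattern is then the difference vector itself, a root, and the normalization `0 ∉ S`
lets `eq_tailSum` recover the vector. -/
lemma facetVectors_zon_circuitVec {φ : Fin (n + 1) ≃ Fin (n + 1)} (h0 : φ 0 = 0)
    {b : Sym2 (Fin (n + 1)) → ℝ} (hb : ∀ m, 0 < b s(φ m, φ (m + 1))) :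
    facetVectors (zon (circuitVec φ b)) = tailSum φ '' rootSystem n := by
  have hc := isPositiveCircuit_circuitVec hb
  ext p
  constructor
  · rintro ⟨⟨S, -, hS0, hp⟩, hF⟩
    obtain ⟨i, j, hij, h⟩ := hc.isFacet_supportFace_iff.1 hF
    refine ⟨root i j, mem_rootSystem_iff.2 ⟨i, j, hij, rfl⟩, (eq_tailSum (sum_root i j) ?_ ?_).symm⟩
    · rw [h0]
      rcases hp with rfl | rfl <;> simp [incidenceVector_apply, hS0]
    · intro m
      rw [← pairSign_cast hij, ← h, dualSign_circuitVec hb]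
      rcases hp with rfl | rfl <;>
        by_cases h1 : φ m ∈ S <;> by_cases h2 : φ (m + 1) ∈ S <;>
          simp [incidenceVector_apply, h1, h2]
  · rintro ⟨t, ht, rfl⟩
    obtain ⟨i, j, hij, rfl⟩ := mem_rootSystem_iff.1 ht
    refine ⟨?_, hc.isFacet_supportFace_iff.2 ⟨i, j, hij, dualSign_tailSum_root hb hij⟩⟩
    rcases lt_or_gt_of_ne hij with h | h
    · refine ⟨arc φ i j, arc_nonempty h, zero_notMem_arc h0 i j, Or.inr ?_⟩
      rw [← tailSum_root h, ← neg_root i j, map_neg, neg_neg]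
    · exact ⟨arc φ j i, arc_nonempty h, zero_notMem_arc h0 j i, Or.inl (tailSum_root h)⟩

lemma existsUnique_facetVector {φ : Fin (n + 1) ≃ Fin (n + 1)} (h0 : φ 0 = 0)
    {b : Sym2 (Fin (n + 1)) → ℝ} (hb : ∀ m, 0 < b s(φ m, φ (m + 1))) {F : Set (Space n)}
    (hF : IsFacet (zon (circuitVec φ b)) F) :
    ∃! p, p ∈ facetVectors (zon (circuitVec φ b)) ∧ F = supportFace (zon (circuitVec φ b)) p := by
  have hc := isPositiveCircuit_circuitVec hb
  rw [facetVectors_zon_circuitVec h0 hb]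
  obtain ⟨i, j, hij, rfl⟩ := hc.isFacet_iff.1 hF
  refine ⟨tailSum φ (root i j), ⟨⟨_, mem_rootSystem_iff.2 ⟨i, j, hij, rfl⟩, rfl⟩, ?_⟩, ?_⟩
  · rw [supportFace_zon, dualSign_tailSum_root hb hij]
  · rintro _ ⟨⟨t, ht, rfl⟩, h⟩
    obtain ⟨i', j', hij', rfl⟩ := mem_rootSystem_iff.1 ht
    rw [supportFace_zon, ← dualSign_tailSum_root hb hij] at h
    have := dualSign_eq_of_signFace_eq h
    rw [dualSign_tailSum_root hb hij, dualSign_tailSum_root hb hij'] at this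
    rw [root_eq_of_pairSign_eq hij hij' this]

lemma val_eq_succ_of_eq_add_one {x y : Fin (n + 1)} (h : y = x + 1) (hy : y ≠ 0) :
    (y : ℕ) = x + 1 := by
  subst h
  rw [Fin.val_add_one, if_neg]
  rintro rfl
  exact hy (Fin.last_add_one n)

/-- A connected set avoiding 0 cannot use the closing step of the circuit, so its positions fill the
interval between their minimum and maximum. -/
lemma IsCircuitParam.isSubchain_iff {C : SimpleGraph (Fin (n + 1))}
    {φ : Fin (n + 1) ≃ Fin (n + 1)} (hφ : IsCircuitParam C φ) {S : Finset (Fin (n + 1))} :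
    IsSubchain C S ↔ ∃ i j, i < j ∧ S = arc φ i j := by
  constructor
  · rintro ⟨hS0, hconn⟩
    have hne : (S.map φ.symm.toEmbedding).Nonempty := by
      obtain ⟨x, hx⟩ := hconn.nonempty
      exact ⟨φ.symm x, by simpa using hx⟩
    have hmem : ∀ k, k ∈ S.map φ.symm.toEmbedding ↔ φ k ∈ S := fun k => by simp
    have hz : ∀ k, φ k ∈ S → k ≠ 0 := by
      rintro k hk rfl
      exact hS0 (hφ.map_zero ▸ hk)
    set a := (S.map φ.symm.toEmbedding).min' hne with ha
    set d := (S.map φ.symm.toEmbedding).max' hne with hd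
    have haS : φ a ∈ S := (hmem _).1 (Finset.min'_mem _ hne)
    have hdS : φ d ∈ S := (hmem _).1 (Finset.max'_mem _ hne)
    have hle : ∀ k, φ k ∈ S → a ≤ k ∧ k ≤ d := fun k hk =>
      ⟨Finset.min'_le _ _ ((hmem k).2 hk), Finset.le_max' _ _ ((hmem k).2 hk)⟩
    have hfill : ∀ c, a < c → c < d → φ c ∈ S := by
      intro c hac hcd
      by_contra hc
      obtain ⟨w⟩ := hconn.preconnected ⟨φ a, haS⟩ ⟨φ d, hdS⟩
      -- Away from position 0 each step changes the position by exactly one, so a walk inside `S`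
      -- cannot jump over the missing position `c`.
      have hwalk : ∀ (x y : (S : Set (Fin (n + 1)))), (C.induce (S : Set (Fin (n + 1)))).Walk x y →
          φ.symm x < c → φ.symm y < c := by
        intro x y w
        induction w with
        | nil => exact id
        | @cons x y z hxy _ ih =>
          intro hx
          refine ih ?_
          obtain ⟨x', hx'⟩ := φ.surjective x.1
          obtain ⟨y', hy'⟩ := φ.surjective y.1
          have hxS : φ x' ∈ S := hx' ▸ x.2
          have hyS : φ y' ∈ S := hy' ▸ y.2
          have hadj : C.Adj (φ x') (φ y') := by
            rw [hx', hy']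
            exact hxy
          rw [← hx', Equiv.symm_apply_apply] at hx
          rw [← hy', Equiv.symm_apply_apply]
          have hyc : y' ≠ c := by
            rintro rfl
            exact hc hyS
          rw [Ne, Fin.ext_iff] at hyc
          rw [Fin.lt_def] at hx ⊢
          rcases (hφ.adj_iff x' y').1 hadj with h | h
          · have := val_eq_succ_of_eq_add_one h (hz _ hyS)
            omega
          · have := val_eq_succ_of_eq_add_one h (hz _ hxS)
            omega
      have := hwalk _ _ w (by simpa using hac)
      simp only [Equiv.symm_apply_apply] at this
      exact absurd hcd (not_lt.2 this.le)
    have ha0 : (a : ℕ) ≠ 0 := fun h => hz a haS (Fin.ext h)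
    -- Arcs are open on the left; `a - 1` is a genuine predecessor because `a` is not 0.
    refine ⟨⟨a - 1, by omega⟩, d, ?_, ?_⟩
    · have := Fin.le_def.1 (hle d hdS).1
      rw [Fin.lt_def]
      dsimp only
      omega
    · ext x
      obtain ⟨k, rfl⟩ := φ.surjective x
      rw [mem_arc, Fin.lt_def]
      dsimp only
      constructor
      · intro hk
        refine ⟨?_, (hle k hk).2⟩
        have := Fin.le_def.1 (hle k hk).1
        omega
      · rintro ⟨h1, h2⟩
        rcases eq_or_lt_of_le h2 with rfl | h2
        · exact hdS
        · have h3 : a ≤ k := Fin.le_def.2 (by omega)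
          rcases eq_or_lt_of_le h3 with h3 | h3
          · rw [← h3]
            exact haS
          · exact hfill k h3 h2
  · rintro ⟨i, j, hij, rfl⟩
    refine ⟨zero_notMem_arc hφ.map_zero i j, ?_⟩
    rw [SimpleGraph.connected_iff_exists_forall_reachable]
    refine ⟨⟨φ j, mem_arc.2 ⟨hij, le_rfl⟩⟩, ?_⟩
    have key : ∀ (t : ℕ) (k : Fin (n + 1)) (hk : i < k ∧ k ≤ j), (k : ℕ) + t = j →
        (C.induce (arc φ i j : Set (Fin (n + 1)))).Reachable ⟨φ j, mem_arc.2 ⟨hij, le_rfl⟩⟩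
          ⟨φ k, mem_arc.2 hk⟩ := by
      intro t
      induction t with
      | zero =>
        intro k hk hkt
        have : k = j := Fin.ext hkt
        subst this
        exact SimpleGraph.Reachable.refl _
      | succ t ih =>
        intro k hk hkt
        have hlast : k ≠ Fin.last n := by
          rintro rfl
          have := j.2
          simp only [Fin.val_last] at hkt
          omega
        have hv : ((k + 1 : Fin (n + 1)) : ℕ) = k + 1 := by rw [Fin.val_add_one, if_neg hlast]
        have hk1 : i < k + 1 ∧ k + 1 ≤ j := by
          rw [Fin.lt_def, Fin.le_def, hv]
          have := Fin.lt_def.1 hk.1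
          omega
        refine (ih (k + 1) hk1 (by omega)).trans (SimpleGraph.Adj.reachable ?_)
        exact (hφ.adj_iff _ _).2 (Or.inr rfl)
    rintro ⟨x, hx⟩
    obtain ⟨k, rfl⟩ := φ.surjective x
    have hk := mem_arc.1 hx
    exact key (j - k) k hk (Nat.add_sub_cancel' hk.2)

lemma IsCircuitParam.two_mul_ncard_subchains {C : SimpleGraph (Fin (n + 1))}
    {φ : Fin (n + 1) ≃ Fin (n + 1)} (hφ : IsCircuitParam C φ) :
    2 * {S | IsSubchain C S}.ncard = n * (n + 1) := by
  have hS : {S | IsSubchain C S} = (fun x : (_ : Fin (n + 1)) × Fin (n + 1) => arc φ x.2 x.1) ''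
      ((Finset.univ.sigma fun j : Fin (n + 1) => Finset.Iio j : Finset _) : Set _) := by
    ext S
    simp only [Set.mem_ofPred_eq, hφ.isSubchain_iff, Set.mem_image, Finset.mem_coe,
      Finset.mem_sigma, Finset.mem_univ, true_and, Finset.mem_Iio, Sigma.exists]
    constructor
    · rintro ⟨i, j, hij, rfl⟩
      exact ⟨j, i, hij, rfl⟩
    · rintro ⟨j, i, hij, rfl⟩
      exact ⟨i, j, hij, rfl⟩
  rw [hS, Set.InjOn.ncard_image, Set.ncard_coe_finset, Finset.card_sigma]
  · simp only [Fin.card_Iio]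
    rw [Fin.sum_univ_eq_sum_range (fun i => i), mul_comm, Finset.sum_range_id_mul_two, mul_comm]
    simp
  · rintro ⟨j, i⟩ hij ⟨j', i'⟩ hij' h
    replace hij : i < j := by simpa using hij
    replace hij' : i' < j' := by simpa using hij'
    dsimp only at h
    -- Arcs with different ends are distinct because they are images of distinct roots under the
    -- injective `tailSum`.
    have h2 : tailSum φ (root j i) = tailSum φ (root j' i') := by
      rw [tailSum_root hij, tailSum_root hij', h]
    have h3 := (root_eq_root_iff hij.ne').1 (tailSum_injective φ h2)
    rw [h3.1, h3.2]

lemma image_tailSum_rootSystem {C : SimpleGraph (Fin (n + 1))}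
    {φ : Fin (n + 1) ≃ Fin (n + 1)} (hφ : IsCircuitParam C φ) :
    tailSum φ '' rootSystem n =
      {p | ∃ S, IsSubchain C S ∧ (p = incidenceVector S ∨ p = -incidenceVector S)} := by
  ext p
  constructor
  · rintro ⟨t, ⟨i, j, hij, rfl | rfl⟩, rfl⟩
    · refine ⟨arc φ i j, hφ.isSubchain_iff.2 ⟨i, j, hij, rfl⟩, Or.inr ?_⟩
      rw [← tailSum_root hij, ← neg_root i j, map_neg, neg_neg]
    · refine ⟨arc φ i j, hφ.isSubchain_iff.2 ⟨i, j, hij, rfl⟩, Or.inl ?_⟩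
      rw [neg_root, tailSum_root hij]
  · rintro ⟨S, hS, hp⟩
    obtain ⟨i, j, hij, rfl⟩ := hφ.isSubchain_iff.1 hS
    rcases hp with rfl | rfl
    · exact ⟨root j i, mem_rootSystem_iff.2 ⟨j, i, hij.ne', rfl⟩, tailSum_root hij⟩
    · refine ⟨root i j, mem_rootSystem_iff.2 ⟨i, j, hij.ne, rfl⟩, ?_⟩
      rw [← tailSum_root hij, ← neg_root j i, map_neg]

end Circuit

/-! ### Zonotopes as base polytopes of cut functions -/

section Zonotopes

variable {ι E : Type*} [Fintype ι] [NormedAddCommGroup E] [InnerProductSpace ℝ E]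

/-- The linear map from coefficients to points of the zonotope. -/
def zonMap (v : ι → E) : (ι → ℝ) →ₗ[ℝ] E :=
  ∑ i, (LinearMap.proj i : (ι → ℝ) →ₗ[ℝ] ℝ).smulRight (v i)

lemma zon_eq_image (v : ι → E) : zon v = zonMap v '' Set.Icc (fun _ => -1) (fun _ => 1) := by
  ext x
  simp [zon, zonMap, Set.mem_image, Set.mem_Icc, Pi.le_def, abs_le, forall_and]

lemma convex_zon (v : ι → E) : Convex ℝ (zon v) := by
  rw [zon_eq_image]
  exact (convex_Icc _ _).linear_image (zonMap v)

lemma isClosed_zon (v : ι → E) : IsClosed (zon v) := by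
  rw [zon_eq_image]
  exact (isCompact_Icc.image (zonMap v).continuous_of_finiteDimensional).isClosed

lemma le_sum_abs_of_mem_zon {v : ι → E} {x : E} (hx : x ∈ zon v) (l : StrongDual ℝ E) :
    l x ≤ ∑ i, |l (v i)| := by
  obtain ⟨c, hc, rfl⟩ := hx
  simp only [map_sum, map_smul, smul_eq_mul]
  exact Finset.sum_le_sum fun i _ => mul_le_abs_of_abs_le_one (hc i)

/-- A point outside the closed convex zonotope is strictly separated from it by a functional, whose
value at the point of matching signs is exactly the bound. -/
lemma mem_zon_of_forall_le {v : ι → E} {x : E}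
    (hx : ∀ l : StrongDual ℝ E, l x ≤ ∑ i, |l (v i)|) : x ∈ zon v := by
  by_contra hnot
  obtain ⟨l, r, hl, hr⟩ := geometric_hahn_banach_closed_point (convex_zon v) (isClosed_zon v) hnot
  have h := hl (∑ i, (SignType.sign (l (v i)) : ℝ) • v i)
    ⟨_, fun i => abs_signType_le_one _, rfl⟩
  simp only [map_sum, map_smul, smul_eq_mul, sign_mul_self] at h
  linarith [hx l]

/-- The map `ρ` sends the sign vectors of `w` onto those of `v`, and the pair `l`, `l'` shows that
it is not injective there. -/
lemma ncard_signVectors_lt {v w : ι → E} (ρ : (ι → SignType) → ι → SignType)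
    (h : ∀ l, dualSign v l = ρ (dualSign w l)) {l l' : StrongDual ℝ E}
    (h1 : dualSign v l = dualSign v l') (h2 : dualSign w l ≠ dualSign w l') :
    (signVectors v).ncard < (signVectors w).ncard := by
  have himg : signVectors v = ρ '' signVectors w := by
    rw [signVectors, signVectors, ← Set.range_comp]
    exact congrArg Set.range (funext h)
  have hfin : (signVectors w).Finite := Set.toFinite _
  rw [himg]
  refine lt_of_le_of_ne (Set.ncard_image_le hfin) fun heq => h2 ?_
  refine (Set.ncard_image_iff hfin).1 heq ⟨l, rfl⟩ ⟨l', rfl⟩ ?_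
  rw [← h, ← h, h1]

end Zonotopes

/-! ### Cut functions: base polytopes, comparison of types, recovery of weights -/

section CutFunctions

variable {n : ℕ}

/-- The weighted edge vectors of a graph, indexed by all pairs of vertices. -/
def edgeVec (G : SimpleGraph (Fin (n + 1))) (b : Sym2 (Fin (n + 1)) → ℝ)
    (u : Fin (n + 1) × Fin (n + 1)) : Space n :=
  if u ∈ edgePairs G then b s(u.1, u.2) • root u.1 u.2 else 0

lemma zonotope_eq_zon_edgeVec (G : SimpleGraph (Fin (n + 1))) (b : Sym2 (Fin (n + 1)) → ℝ) :
    zonotope G b = zon (edgeVec G b) :=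
  zonotope_eq_zon G b

lemma edge_nonneg {G : SimpleGraph (Fin (n + 1))} {b : Sym2 (Fin (n + 1)) → ℝ}
    (hb : ∀ e ∈ G.edgeSet, 0 ≤ b e) {u : Fin (n + 1) × Fin (n + 1)} (hu : u ∈ edgePairs G) :
    0 ≤ b s(u.1, u.2) :=
  hb _ (mem_edgePairs.1 hu).2

lemma sum_abs_edgeVec {G : SimpleGraph (Fin (n + 1))} {b : Sym2 (Fin (n + 1)) → ℝ}
    (hb : ∀ e ∈ G.edgeSet, 0 ≤ b e) (p : Space n) :
    ∑ u, |innerSL ℝ p (edgeVec G b u)| =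
      ∑ u ∈ edgePairs G, b s(u.1, u.2) * |p u.1 - p u.2| := by
  rw [← Finset.sum_subset (Finset.subset_univ (edgePairs G))]
  · refine Finset.sum_congr rfl fun u hu => ?_
    rw [edgeVec, if_pos hu, innerSL_apply_apply, inner_smul_right, inner_root_right, abs_mul,
      abs_of_nonneg (edge_nonneg hb hu)]
  · intro u _ hu
    simp [edgeVec, hu]

/-- Induction on the number of values of `p`. Lowering the largest value M to the next one M' on its
level set S changes the left side by (M - M') times the sum of `x` over S and the right side by (M -
M') times the cut of S, and these are compared by the inequality for S. A constant `p` gives 0 on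
both sides. -/
lemma sum_mul_le_of_le_cut {G : SimpleGraph (Fin (n + 1))} {b : Sym2 (Fin (n + 1)) → ℝ}
    {x : Space n} (hx : x ∈ basePolytope (cutFunction G b)) (p : Fin (n + 1) → ℝ) :
    ∑ i, p i * x i ≤ ∑ u ∈ edgePairs G, b s(u.1, u.2) * |p u.1 - p u.2| := by
  classical
  obtain ⟨hS, h0⟩ := hx
  induction hk : (Finset.univ.image p).card using Nat.strong_induction_on generalizing p with
  | _ k ih =>
  have hne : (Finset.univ.image p).Nonempty := ⟨p 0, by simp⟩
  set M := (Finset.univ.image p).max' hne with hM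
  have hMmem : M ∈ Finset.univ.image p := Finset.max'_mem _ _
  have hle : ∀ i, p i ≤ M := fun i => Finset.le_max' _ _ (by simp)
  by_cases hconst : ∀ i, p i = M
  · simp [hconst, ← Finset.mul_sum, h0]
  push Not at hconst
  obtain ⟨i₀, hi₀⟩ := hconst
  have hne' : ((Finset.univ.image p).erase M).Nonempty :=
    ⟨p i₀, Finset.mem_erase.2 ⟨hi₀, by simp⟩⟩
  set M' := ((Finset.univ.image p).erase M).max' hne' with hM'
  have hM'mem : M' ∈ (Finset.univ.image p).erase M := Finset.max'_mem _ _
  have hM'M : M' < M := by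
    obtain ⟨h1, h2⟩ := Finset.mem_erase.1 hM'mem
    exact lt_of_le_of_ne (Finset.le_max' _ _ h2) h1
  have hle' : ∀ i, p i ≠ M → p i ≤ M' := fun i hi =>
    Finset.le_max' _ _ (Finset.mem_erase.2 ⟨hi, by simp⟩)
  set S : Finset (Fin (n + 1)) := Finset.univ.filter fun i => p i = M with hSdef
  have hSu : S ⊂ Finset.univ := by
    rw [Finset.ssubset_univ_iff]
    intro h
    have : i₀ ∈ S := h ▸ Finset.mem_univ _
    exact hi₀ (by simpa [S] using this)
  have hmemS : ∀ i, i ∈ S ↔ p i = M := fun i => by simp [S]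
  let p' : Fin (n + 1) → ℝ := fun i => if p i = M then M' else p i
  have hcard : (Finset.univ.image p').card < k := by
    rw [← hk]
    refine (Finset.card_le_card ?_).trans_lt (Finset.card_erase_lt_of_mem hMmem)
    intro y hy
    obtain ⟨i, -, rfl⟩ := Finset.mem_image.1 hy
    by_cases hi : p i = M
    · simpa [p', hi] using hM'mem
    · simp [p', hi]
  have h1 := ih _ hcard p' rfl
  have h2 := mul_le_mul_of_nonneg_left (hS S hSu) (sub_nonneg.2 hM'M.le)
  have h3 : ∑ i, p i * x i = ∑ i, p' i * x i + (M - M') * ∑ i ∈ S, x i := by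
    rw [hSdef, Finset.sum_filter, Finset.mul_sum, ← Finset.sum_add_distrib]
    refine Finset.sum_congr rfl fun i _ => ?_
    by_cases hi : p i = M
    · simp only [p', hi, if_true]
      ring
    · simp [p', hi]
  -- Only edges leaving S are affected. Their other end is at most M', so each absolute value drops
  -- by exactly M - M'.
  have h4 : ∑ u ∈ edgePairs G, b s(u.1, u.2) * |p u.1 - p u.2| =
      ∑ u ∈ edgePairs G, b s(u.1, u.2) * |p' u.1 - p' u.2| + (M - M') * cutFunction G b S := by
    rw [cutFunction, Finset.sum_filter, Finset.mul_sum, ← Finset.sum_add_distrib]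
    refine Finset.sum_congr rfl fun u _ => ?_
    simp only [hmemS]
    by_cases ha : p u.1 = M <;> by_cases hc : p u.2 = M
    · simp [p', ha, hc]
    · have := hle' _ hc
      simp only [p', ha, hc, if_true, if_false, not_false_iff]
      rw [abs_of_nonneg (by linarith), abs_of_nonneg (by linarith)]
      ring
    · have := hle' _ ha
      simp only [p', ha, hc, if_true, if_false, not_true]
      rw [abs_of_nonpos (by linarith), abs_of_nonpos (by linarith)]
      ring
    · simp [p', ha, hc]
  rw [h3, h4]
  exact add_le_add h1 h2

lemma zonotope_eq_basePolytope {G : SimpleGraph (Fin (n + 1))} {b : Sym2 (Fin (n + 1)) → ℝ}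
    (hb : ∀ e ∈ G.edgeSet, 0 ≤ b e) : zonotope G b = basePolytope (cutFunction G b) := by
  classical
  rw [zonotope_eq_zon_edgeVec]
  ext x
  constructor
  · intro hx
    constructor
    · intro S _
      have h := le_sum_abs_of_mem_zon hx (innerSL ℝ (incidenceVector S))
      rw [sum_abs_edgeVec hb] at h
      have h1 : innerSL ℝ (incidenceVector S) x = ∑ i ∈ S, x i := by
        simp [incidenceVector, EuclideanSpace.inner_single_left]
      rw [h1] at h
      refine h.trans_eq ?_
      rw [cutFunction, Finset.sum_filter]
      refine Finset.sum_congr rfl fun u _ => ?_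
      simp only [incidenceVector_apply]
      by_cases h1 : u.1 ∈ S <;> by_cases h2 : u.2 ∈ S <;> simp [h1, h2]
    · obtain ⟨c, -, rfl⟩ := hx
      rw [← mem_span_rootLattice_iff]
      refine Submodule.sum_mem _ fun u _ => Submodule.smul_mem _ _ ?_
      rw [edgeVec]
      split_ifs
      · exact Submodule.smul_mem _ _ (Submodule.subset_span (root_mem_rootLattice _ _))
      · exact Submodule.zero_mem _
  · intro hx
    refine mem_zon_of_forall_le fun l => ?_
    obtain ⟨p, rfl⟩ := (InnerProductSpace.toDual ℝ (Space n)).surjective l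
    have h := sum_mul_le_of_le_cut hx p
    rw [← sum_abs_edgeVec hb] at h
    refine le_of_eq_of_le ?_ h
    rw [InnerProductSpace.toDual_apply_apply, PiLp.inner_apply]
    exact Finset.sum_congr rfl fun i _ => mul_comm _ _

lemma dualSign_edgeVec {G : SimpleGraph (Fin (n + 1))} {b : Sym2 (Fin (n + 1)) → ℝ}
    (hb : ∀ e ∈ G.edgeSet, 0 ≤ b e) (p : Space n) (u : Fin (n + 1) × Fin (n + 1)) :
    dualSign (edgeVec G b) (innerSL ℝ p) u =
      open Classical in
      if u.1 < u.2 ∧ G.Adj u.1 u.2 ∧ 0 < b s(u.1, u.2) then SignType.sign (p u.1 - p u.2)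
      else 0 := by
  classical
  by_cases hu : u ∈ edgePairs G
  · have hu' := mem_edgePairs.1 hu
    rw [dualSign, edgeVec, if_pos hu, innerSL_apply_apply, inner_smul_right, inner_root_right]
    rcases (edge_nonneg hb hu).eq_or_lt with h | h
    · simp [← h]
    · rw [if_pos ⟨hu'.1, hu'.2, h⟩, sign_mul_of_pos h]
  · rw [if_neg fun h => hu (mem_edgePairs.2 ⟨h.1, h.2.1⟩)]
    simp [dualSign, edgeVec, hu]

/-- Sign vectors of the smaller graph are those of the larger one with the extra entries set to
zero. If `p` and `p'` agree on the smaller graph but not on some edge of the larger one, this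
restriction loses sign vectors, and the numbers of faces differ. -/
lemma not_sameType_zonotope {G H : SimpleGraph (Fin (n + 1))} {b d : Sym2 (Fin (n + 1)) → ℝ}
    (hb : ∀ e ∈ G.edgeSet, 0 ≤ b e) (hd : ∀ e ∈ H.edgeSet, 0 ≤ d e)
    (hsub : ∀ a c, G.Adj a c → 0 < b s(a, c) → H.Adj a c ∧ 0 < d s(a, c)) {p p' : Space n}
    (hp : ∀ a c, G.Adj a c → 0 < b s(a, c) →
      SignType.sign (p a - p c) = SignType.sign (p' a - p' c))
    {a₀ c₀ : Fin (n + 1)} (hadj : H.Adj a₀ c₀) (hpos : 0 < d s(a₀, c₀))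
    (hne : SignType.sign (p a₀ - p c₀) ≠ SignType.sign (p' a₀ - p' c₀)) :
    ¬ SameType (zonotope G b) (zonotope H d) := by
  classical
  intro h
  have hcard := h.natCard_eq
  rw [zonotope_eq_zon_edgeVec, zonotope_eq_zon_edgeVec, natCard_faceLattice_zon,
    natCard_faceLattice_zon, add_left_inj] at hcard
  refine (ncard_signVectors_lt (v := edgeVec G b) (w := edgeVec H d)
    (fun σ u => if u.1 < u.2 ∧ G.Adj u.1 u.2 ∧ 0 < b s(u.1, u.2) then σ u else 0)
    ?_ (l := innerSL ℝ p) (l' := innerSL ℝ p') ?_ ?_).ne hcard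
  · intro l
    obtain ⟨q, rfl⟩ := (InnerProductSpace.toDual ℝ (Space n)).surjective l
    funext u
    change dualSign (edgeVec G b) (innerSL ℝ q) u =
      if _ then dualSign (edgeVec H d) (innerSL ℝ q) u else 0
    rw [dualSign_edgeVec hb, dualSign_edgeVec hd]
    split_ifs with h1 h2
    · rfl
    · exact absurd ⟨h1.1, hsub _ _ h1.2.1 h1.2.2⟩ h2
    · rfl
  · funext u
    rw [dualSign_edgeVec hb, dualSign_edgeVec hb]
    split_ifs with h1
    · exact hp _ _ h1.2.1 h1.2.2
    · rfl
  · intro heq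
    wlog hlt : a₀ < c₀ generalizing a₀ c₀
    · refine this hadj.symm (by rwa [Sym2.eq_swap]) ?_ (lt_of_le_of_ne (not_lt.1 hlt) hadj.ne')
      rw [← neg_sub, Left.sign_neg, ← neg_sub (p' a₀), Left.sign_neg]
      exact fun h => hne (neg_injective h)
    · have := congrFun heq (a₀, c₀)
      rw [dualSign_edgeVec hd, dualSign_edgeVec hd, if_pos ⟨hlt, hadj, hpos⟩,
        if_pos ⟨hlt, hadj, hpos⟩] at this
      exact hne this

/-- The weight of the pair `{i, j}`, recovered from a cut function. -/
def cutWeight (β : Finset (Fin (n + 1)) → ℝ) (i j : Fin (n + 1)) : ℝ :=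
  (β {i} + β {j} - β {i, j}) / 2

/-- The edge {i, j} is cut by each singleton but not by the pair, so it counts twice; every other
edge cancels. -/
lemma cutWeight_cutFunction {G : SimpleGraph (Fin (n + 1))} (b : Sym2 (Fin (n + 1)) → ℝ)
    {i j : Fin (n + 1)} (hadj : G.Adj i j) : cutWeight (cutFunction G b) i j = b s(i, j) := by
  classical
  wlog hlt : i < j generalizing i j
  · have := this hadj.symm (lt_of_le_of_ne (not_lt.1 hlt) hadj.ne')
    rwa [Sym2.eq_swap, cutWeight, add_comm, Finset.pair_comm] at this
  have hij := hadj.ne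
  simp only [cutWeight, cutFunction, Finset.sum_filter, ← Finset.sum_add_distrib,
    ← Finset.sum_sub_distrib]
  rw [Finset.sum_eq_single (i, j)]
  · simp [hij, hij.symm]
  · rintro ⟨a, c⟩ hu hne
    have hlt' : a < c := (mem_edgePairs.1 hu).1
    simp only [Finset.mem_singleton, Finset.mem_insert]
    have hac := hlt'.ne
    by_cases h1 : a = i
    · subst h1
      have h2 : c ≠ j := fun h => hne (by rw [h])
      simp [hac.symm, h2, hij]
    · by_cases h2 : a = j
      · subst h2
        have h3 : c ≠ i := fun h => absurd hlt (not_lt.2 (h ▸ hlt'.le))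
        simp [hac.symm, h1, h3]
      · by_cases h3 : c = i <;> by_cases h4 : c = j <;> simp [h1, h2, h3, h4, hij, hij.symm]
  · intro h
    exact absurd (mem_edgePairs.2 ⟨hlt, hadj⟩) h

lemma cutFunction_top_eq {G : SimpleGraph (Fin (n + 1))} {b d : Sym2 (Fin (n + 1)) → ℝ}
    (hbd : ∀ i j, G.Adj i j → b s(i, j) = d s(i, j))
    (h0 : ∀ i j, i ≠ j → ¬ G.Adj i j → b s(i, j) = 0) : cutFunction ⊤ b = cutFunction G d := by
  classical
  funext S
  simp only [cutFunction, Finset.sum_filter]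
  symm
  have hsub : edgePairs G ⊆ edgePairs ⊤ := fun u hu => by
    rw [mem_edgePairs] at hu ⊢
    exact ⟨hu.1, hu.1.ne⟩
  rw [← Finset.sum_subset hsub]
  · refine Finset.sum_congr rfl fun u hu => ?_
    rw [hbd _ _ (mem_edgePairs.1 hu).2]
  · intro u hu hu'
    rw [mem_edgePairs] at hu hu'
    rw [h0 _ _ hu.1.ne fun h => hu' ⟨hu.1, h⟩, ite_self]

lemma cutFunction_mem_cutFunctions {G : SimpleGraph (Fin (n + 1))}
    {b : Sym2 (Fin (n + 1)) → ℝ} (hb : ∀ e ∈ G.edgeSet, 0 ≤ b e) :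
    cutFunction G b ∈ cutFunctions n := by
  classical
  refine ⟨fun e => if e ∈ G.edgeSet then b e else 0, fun e => ?_, ?_⟩
  · dsimp only
    split_ifs with h
    · exact hb e h
    · exact le_rfl
  · refine (cutFunction_top_eq (fun i j hij => ?_) fun i j _ hij => ?_).symm
    · exact if_pos hij
    · exact if_neg hij

/-- Applied to the open positive orthant, this yields both dimension counts, of the cut cone and of
the forms. -/
lemma vectorSpan_image_of_isOpen {V W : Type*} [NormedAddCommGroup V] [NormedSpace ℝ V]
    [AddCommGroup W] [Module ℝ W] (L : V →ₗ[ℝ] W) {U : Set V} (hU : IsOpen U)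
    (hne : U.Nonempty) : vectorSpan ℝ (L '' U) = LinearMap.range L := by
  have h := AffineMap.map_vectorSpan (f := L.toAffineMap) (s := U)
  rw [← direction_affineSpan, hU.affineSpan_eq_top hne, AffineSubspace.direction_top,
    LinearMap.toAffineMap_linear, Submodule.map_top] at h
  exact h.symm

lemma isOpen_positive_orthant (ι : Type*) [Finite ι] : IsOpen {a : ι → ℝ | ∀ i, 0 < a i} := by
  rw [Set.ofPred_forall]
  exact isOpen_iInter_of_finite fun i => isOpen_lt continuous_const (continuous_apply i)

end CutFunctions

/-! ### The type domain of the circuit polytope -/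

section TypeDomain

variable {n : ℕ} {C : SimpleGraph (Fin (n + 1))} {φ : Fin (n + 1) ≃ Fin (n + 1)}

open Classical in
/-- The cut function of a circuit as a linear function of its weights in cyclic order. -/
def circuitCut (φ : Fin (n + 1) ≃ Fin (n + 1)) :
    (Fin (n + 1) → ℝ) →ₗ[ℝ] (Finset (Fin (n + 1)) → ℝ) where
  toFun a S := ∑ m, if (φ m ∈ S ↔ φ (m + 1) ∉ S) then a m else 0
  map_add' a c := by
    funext S
    simp only [Pi.add_apply, ← Finset.sum_add_distrib]
    refine Finset.sum_congr rfl fun m _ => ?_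
    split_ifs <;> simp
  map_smul' r a := by
    funext S
    simp [Finset.mul_sum]

lemma IsCircuitParam.cutFunction_eq (hφ : IsCircuitParam C φ) (b : Sym2 (Fin (n + 1)) → ℝ) :
    cutFunction C b = circuitCut φ fun m => b s(φ m, φ (m + 1)) := by
  classical
  funext S
  simp only [cutFunction, Finset.sum_filter]
  exact hφ.sum_edgePairs (fun i j => if (i ∈ S ↔ j ∉ S) then b s(i, j) else 0) fun i j => by
    rw [Sym2.eq_swap]
    exact if_congr (by tauto) rfl rfl

lemma IsCircuitParam.edge_injective (hφ : IsCircuitParam C φ) :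
    Function.Injective fun m => s(φ m, φ (m + 1)) := by
  intro a b h
  rcases Sym2.eq_iff.1 h with h | ⟨h1, h2⟩
  · exact φ.injective h.1
  · have h1 := φ.injective h1
    have h2 := φ.injective h2
    rw [h1, add_assoc, add_eq_left] at h2
    exact absurd h2 (two_ne_zero_of_two_le hφ.two_le)

lemma IsCircuitParam.exists_weight (hφ : IsCircuitParam C φ) (a : Fin (n + 1) → ℝ) :
    ∃ b : Sym2 (Fin (n + 1)) → ℝ, ∀ m, b s(φ m, φ (m + 1)) = a m :=
  ⟨Function.extend (fun m => s(φ m, φ (m + 1))) a 0, fun m =>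
    hφ.edge_injective.extend_apply a 0 m⟩

lemma IsCircuitParam.exists_of_adj (hφ : IsCircuitParam C φ) {i j : Fin (n + 1)}
    (h : C.Adj i j) : ∃ m, (i = φ m ∧ j = φ (m + 1)) ∨ (j = φ m ∧ i = φ (m + 1)) := by
  obtain ⟨x, rfl⟩ := φ.surjective i
  obtain ⟨y, rfl⟩ := φ.surjective j
  rcases (hφ.adj_iff x y).1 h with rfl | rfl
  · exact ⟨x, Or.inl ⟨rfl, rfl⟩⟩
  · exact ⟨y, Or.inr ⟨rfl, rfl⟩⟩

lemma IsCircuitParam.adj (hφ : IsCircuitParam C φ) (m : Fin (n + 1)) :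
    C.Adj (φ m) (φ (m + 1)) :=
  (hφ.adj_iff _ _).2 (Or.inl rfl)

lemma IsCircuitParam.circuitCut_injective (hφ : IsCircuitParam C φ) :
    Function.Injective (circuitCut φ) := by
  intro a a' h
  obtain ⟨b, hb⟩ := hφ.exists_weight a
  obtain ⟨b', hb'⟩ := hφ.exists_weight a'
  rw [← funext hb, ← funext hb', ← hφ.cutFunction_eq, ← hφ.cutFunction_eq] at h
  funext m
  rw [← hb, ← hb', ← cutWeight_cutFunction b (hφ.adj m), h, cutWeight_cutFunction b' (hφ.adj m)]

lemma IsCircuitParam.openCutCone_eq (hφ : IsCircuitParam C φ) :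
    openCutCone C = circuitCut φ '' {a | ∀ m, 0 < a m} := by
  ext β
  constructor
  · rintro ⟨b, hb, rfl⟩
    exact ⟨_, hφ.weight_pos hb, (hφ.cutFunction_eq b).symm⟩
  · rintro ⟨a, ha, rfl⟩
    obtain ⟨b, hb⟩ := hφ.exists_weight a
    refine ⟨b, fun e he => ?_, by rw [hφ.cutFunction_eq, funext hb]⟩
    induction e with
    | _ i j =>
      obtain ⟨m, ⟨rfl, rfl⟩ | ⟨rfl, rfl⟩⟩ := hφ.exists_of_adj he
      · rw [hb]
        exact ha m
      · rw [Sym2.eq_swap, hb]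
        exact ha m

lemma IsCircuitParam.setDim_openCutCone (hφ : IsCircuitParam C φ) :
    setDim (openCutCone C) = n + 1 := by
  have hne : {a : Fin (n + 1) → ℝ | ∀ m, 0 < a m}.Nonempty := ⟨fun _ => 1, fun _ => one_pos⟩
  rw [setDim, hφ.openCutCone_eq, vectorSpan_image_of_isOpen _ (isOpen_positive_orthant _) hne,
    LinearMap.finrank_range_of_inj hφ.circuitCut_injective,
    Module.finrank_fin_fun]

lemma IsCircuitParam.isPreconnected_openCutCone (hφ : IsCircuitParam C φ) :
    IsPreconnected (openCutCone C) := by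
  rw [hφ.openCutCone_eq]
  refine (Convex.linear_image ?_ (circuitCut φ)).isPreconnected
  intro a ha c hc s t hs ht hst m
  have h1 := ha m
  have h2 := hc m
  simp only [Pi.add_apply, Pi.smul_apply, smul_eq_mul]
  rcases hs.eq_or_lt with rfl | hs
  · rw [zero_add] at hst
    subst hst
    simpa using h2
  · exact add_pos_of_pos_of_nonneg (mul_pos hs h1) (mul_nonneg ht h2.le)

lemma IsCircuitParam.not_sameType_of_chord (hφ : IsCircuitParam C φ)
    {b d : Sym2 (Fin (n + 1)) → ℝ} (hb : ∀ e ∈ C.edgeSet, 0 < b e) (hd : ∀ e, 0 ≤ d e)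
    (hC : ∀ m, 0 < d s(φ m, φ (m + 1))) {i j : Fin (n + 1)} (hij : i ≠ j)
    (hadj : ¬ C.Adj i j) (hpos : 0 < d s(i, j)) :
    ¬ SameType (zonotope C b) (zonotope ⊤ d) := by
  classical
  -- The two vectors order the vertices alike except that `i` and `j` are interchanged at the top,
  -- so only the chord between them sees a difference.
  refine not_sameType_zonotope (fun e he => (hb e he).le) (fun e _ => hd e) ?_
    (p := WithLp.toLp 2 fun k => if k = i then 2 else if k = j then 1 else 0)
    (p' := WithLp.toLp 2 fun k => if k = i then 1 else if k = j then 2 else 0)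
    ?_ (a₀ := i) (c₀ := j) hij hpos ?_
  · intro a c hac _
    refine ⟨hac.ne, ?_⟩
    obtain ⟨m, ⟨rfl, rfl⟩ | ⟨rfl, rfl⟩⟩ := hφ.exists_of_adj hac
    · exact hC m
    · rw [Sym2.eq_swap]
      exact hC m
  · intro a c hac _
    have h1 : ¬ (a = i ∧ c = j) := by
      rintro ⟨rfl, rfl⟩
      exact hadj hac
    have h2 : ¬ (a = j ∧ c = i) := by
      rintro ⟨rfl, rfl⟩
      exact hadj hac.symm
    dsimp only
    split_ifs <;> first | tauto | norm_num
  · simp only [if_true, hij.symm, if_false]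
    norm_num

lemma IsCircuitParam.not_sameType_of_missing (hφ : IsCircuitParam C φ)
    {b d : Sym2 (Fin (n + 1)) → ℝ} (hb : ∀ e ∈ C.edgeSet, 0 < b e) (hd : ∀ e, 0 ≤ d e)
    (hC : ∀ i j, i ≠ j → ¬ C.Adj i j → d s(i, j) = 0) {m₀ : Fin (n + 1)}
    (h0 : d s(φ m₀, φ (m₀ + 1)) = 0) : ¬ SameType (zonotope ⊤ d) (zonotope C b) := by
  classical
  obtain ⟨a, c, ha, hc, hac⟩ : ∃ a c : Fin (n + 1), a ≠ m₀ ∧ c ≠ m₀ ∧ a ≠ c := by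
    have h1 := ne_add_one_of_two_le hφ.two_le m₀
    have h2 := ne_add_one_of_two_le hφ.two_le (m₀ + 1)
    refine ⟨m₀ + 1, m₀ + 1 + 1, h1.symm, fun h => ?_, h2⟩
    rw [add_assoc, add_eq_left] at h
    exact two_ne_zero_of_two_le hφ.two_le h
  -- Prescribed differences along the circuit: at a, m₀, c they are 2, -1, -1 for `r` and 1, 1, -2
  -- for `r'`. Both sum to zero, and the signs differ only at the missing edge m₀.
  let r : Space n := root a m₀ + root a c
  let r' : Space n := root a c + root m₀ c
  have hr : ∑ m, r m = 0 := by simp [r, Finset.sum_add_distrib, sum_root]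
  have hr' : ∑ m, r' m = 0 := by simp [r', Finset.sum_add_distrib, sum_root]
  have hadj : ∀ i j, i ≠ j → 0 < d s(i, j) → C.Adj i j := fun i j hij hpos => by
    by_contra h
    exact hpos.ne' (hC i j hij h)
  have hsign : ∀ m, m ≠ m₀ → SignType.sign (r m) = SignType.sign (r' m) := by
    intro m hm
    simp only [r, r', PiLp.add_apply, root_apply, hm, if_false]
    split_ifs with h1 h2 <;> first | exact absurd (h1.symm.trans h2) hac | norm_num
  refine not_sameType_zonotope (fun e _ => hd e) (fun e he => (hb e he).le) ?_
    (p := tailSum φ r) (p' := tailSum φ r')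
    ?_ (a₀ := φ m₀) (c₀ := φ (m₀ + 1)) (hφ.adj m₀) (hb _ (hφ.adj m₀)) ?_
  · intro i j hij hpos
    exact ⟨hadj i j hij hpos, hb _ (hadj i j hij hpos)⟩
  · intro i j hij hpos
    obtain ⟨m, ⟨rfl, rfl⟩ | ⟨rfl, rfl⟩⟩ := hφ.exists_of_adj (hadj i j hij hpos)
    · rw [tailSum_sub hr, tailSum_sub hr']
      refine hsign m ?_
      rintro rfl
      exact hpos.ne' h0
    · rw [← neg_sub, Left.sign_neg, ← neg_sub (tailSum φ r' _), Left.sign_neg, tailSum_sub hr,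
        tailSum_sub hr', hsign m]
      rintro rfl
      rw [Sym2.eq_swap] at hpos
      exact hpos.ne' h0
  · rw [tailSum_sub hr, tailSum_sub hr']
    simp [r, r', root_apply, ha.symm, hc.symm]

lemma IsCircuitParam.sameType_zonotope (hφ : IsCircuitParam C φ)
    {b d : Sym2 (Fin (n + 1)) → ℝ} (hb : ∀ e ∈ C.edgeSet, 0 < b e)
    (hd : ∀ e ∈ C.edgeSet, 0 < d e) : SameType (zonotope C b) (zonotope C d) := by
  rw [hφ.zonotope_eq, hφ.zonotope_eq]
  exact (isPositiveCircuit_circuitVec (hφ.weight_pos hb)).sameType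
    (isPositiveCircuit_circuitVec (hφ.weight_pos hd))

/-- Weights are continuous functions of β through `cutWeight`. Among the cut functions of this type,
U (all circuit weights positive) and V (some chord weight nonzero) are disjoint because adding a
chord changes the type, and they cover because deleting a circuit edge does. The component of
`cutFunction C b` therefore stays in U, where all chord weights vanish. -/
lemma IsCircuitParam.typeDomain_eq (hφ : IsCircuitParam C φ) {b : Sym2 (Fin (n + 1)) → ℝ}
    (hb : ∀ e ∈ C.edgeSet, 0 < b e) : typeDomain (cutFunction C b) = openCutCone C := by
  set T : Set (Finset (Fin (n + 1)) → ℝ) := {β | β ∈ cutFunctions n ∧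
    SameType (basePolytope β) (basePolytope (cutFunction C b))} with hT
  have hcone : openCutCone C ⊆ T := by
    rintro _ ⟨d, hd, rfl⟩
    refine ⟨cutFunction_mem_cutFunctions fun e he => (hd e he).le, ?_⟩
    rw [← zonotope_eq_basePolytope fun e he => (hd e he).le,
      ← zonotope_eq_basePolytope fun e he => (hb e he).le]
    exact hφ.sameType_zonotope hd hb
  have hmem : cutFunction C b ∈ openCutCone C := ⟨b, hb, rfl⟩
  refine Set.Subset.antisymm ?_
    (hφ.isPreconnected_openCutCone.subset_connectedComponentIn hmem hcone)
  have hsubT : typeDomain (cutFunction C b) ⊆ T := connectedComponentIn_subset _ _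
  have hconn : IsPreconnected (typeDomain (cutFunction C b)) :=
    isPreconnected_connectedComponentIn
  have hmem' : cutFunction C b ∈ typeDomain (cutFunction C b) :=
    mem_connectedComponentIn (hcone hmem)
  have hcont : ∀ i j, Continuous fun β : Finset (Fin (n + 1)) → ℝ => cutWeight β i j := by
    intro i j
    unfold cutWeight
    fun_prop
  let U : Set (Finset (Fin (n + 1)) → ℝ) := {β | ∀ m, 0 < cutWeight β (φ m) (φ (m + 1))}
  let V : Set (Finset (Fin (n + 1)) → ℝ) :=
    {β | ∃ i j, i ≠ j ∧ ¬ C.Adj i j ∧ cutWeight β i j ≠ 0}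
  have hU : IsOpen U := by
    change IsOpen {β | ∀ m, _}
    rw [Set.ofPred_forall]
    exact isOpen_iInter_of_finite fun m => isOpen_lt continuous_const (hcont _ _)
  have hV : IsOpen V := by
    have : V = ⋃ i, ⋃ j, ⋃ (_ : i ≠ j ∧ ¬ C.Adj i j), {β | cutWeight β i j ≠ 0} := by
      ext β
      simp [V, and_assoc]
    rw [this]
    exact isOpen_iUnion fun i => isOpen_iUnion fun j => isOpen_iUnion fun _ =>
      isOpen_ne_fun (hcont _ _) continuous_const
  have hweight : ∀ (d : Sym2 (Fin (n + 1)) → ℝ) (i j : Fin (n + 1)), i ≠ j →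
      cutWeight (cutFunction ⊤ d) i j = d s(i, j) := fun d i j hij => cutWeight_cutFunction d hij
  have hUV : ∀ β ∈ T, β ∉ V → β ∈ openCutCone C ∧ β ∈ U := by
    rintro _ ⟨⟨d, hd, rfl⟩, htype⟩ hβ
    rw [← zonotope_eq_basePolytope fun e _ => hd e,
      ← zonotope_eq_basePolytope fun e he => (hb e he).le] at htype
    have h0 : ∀ i j, i ≠ j → ¬ C.Adj i j → d s(i, j) = 0 := by
      intro i j hij hadj
      by_contra h
      exact hβ ⟨i, j, hij, hadj, by rwa [hweight d i j hij]⟩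
    have hpos : ∀ m, 0 < d s(φ m, φ (m + 1)) := by
      intro m
      refine lt_of_le_of_ne (hd _) fun h => ?_
      exact hφ.not_sameType_of_missing hb hd h0 h.symm htype
    refine ⟨⟨d, fun e he => ?_, cutFunction_top_eq (fun _ _ _ => rfl) h0⟩, fun m => ?_⟩
    · induction e with
      | _ i j =>
        obtain ⟨m, ⟨rfl, rfl⟩ | ⟨rfl, rfl⟩⟩ := hφ.exists_of_adj he
        · exact hpos m
        · rw [Sym2.eq_swap]
          exact hpos m
    · rw [hweight d _ _ (hφ.adj m).ne]
      exact hpos m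
  have hdisj : ∀ β ∈ T, β ∈ U → β ∉ V := by
    rintro _ ⟨⟨d, hd, rfl⟩, htype⟩ hβU ⟨i, j, hij, hadj, hne⟩
    rw [← zonotope_eq_basePolytope fun e _ => hd e,
      ← zonotope_eq_basePolytope fun e he => (hb e he).le] at htype
    rw [hweight d i j hij] at hne
    refine hφ.not_sameType_of_chord hb hd (fun m => ?_) hij hadj
      (lt_of_le_of_ne (hd _) hne.symm) htype.symm
    rw [← hweight d _ _ (hφ.adj m).ne]
    exact hβU m
  have hmemU : cutFunction C b ∈ U := fun m => by
    rw [cutWeight_cutFunction b (hφ.adj m)]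
    exact hφ.weight_pos hb m
  rcases isPreconnected_iff_subset_of_disjoint.1 hconn U V hU hV
    (fun β hβ => or_iff_not_imp_right.2 fun h => (hUV β (hsubT hβ) h).2)
    (Set.eq_empty_of_forall_notMem fun β hβ => hdisj β (hsubT hβ.1) hβ.2.1 hβ.2.2) with h | h
  · exact fun β hβ => (hUV β (hsubT hβ) (hdisj β (hsubT hβ) (h hβ))).1
  · exact absurd (h hmem') (hdisj _ (hsubT hmem') hmemU)

end TypeDomain

/-! ### The non-rigidity degree of the root lattice -/

section NonRigidity

variable {n : ℕ}

/-- The hyperplane `∑ xᵢ = 0`, as the real span of the root lattice. -/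
abbrev rootSpan (n : ℕ) : Submodule ℝ (Space n) :=
  Submodule.span ℝ (rootLattice n : Set (Space n))

/-- The root `eᵢ - eⱼ` as a vector of the hyperplane. -/
def spanRoot (i j : Fin (n + 1)) : rootSpan n :=
  ⟨root i j, Submodule.subset_span (root_mem_rootLattice i j)⟩

lemma spanRoot_apply (i j m : Fin (n + 1)) :
    (spanRoot i j : Space n) m = (if m = i then 1 else 0) - (if m = j then 1 else 0) :=
  root_apply i j m

lemma spanRoot_apply_of_ne {i j m : Fin (n + 1)} (hi : m ≠ i) (hj : m ≠ j) :
    (spanRoot i j : Space n) m = 0 := by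
  simp [spanRoot_apply, hi, hj]

lemma abs_spanRoot_le_one (i j m : Fin (n + 1)) : |(spanRoot i j : Space n) m| ≤ 1 := by
  rw [spanRoot_apply]
  split_ifs <;> norm_num

lemma neg_spanRoot (i j : Fin (n + 1)) : -spanRoot i j = spanRoot j i :=
  Subtype.ext (neg_root i j)

lemma spanRoot_self (i : Fin (n + 1)) : spanRoot i i = 0 := Subtype.ext (root_self i)

lemma spanRoot_add (i j k : Fin (n + 1)) : spanRoot i j + spanRoot j k = spanRoot i k :=
  Subtype.ext (root_add_root i j k)

/-- A coordinate of the hyperplane. -/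
def spanCoord (k : Fin (n + 1)) : rootSpan n →ₗ[ℝ] ℝ :=
  (LinearMap.proj k).comp
    ((WithLp.linearEquiv 2 ℝ (Fin (n + 1) → ℝ)).toLinearMap.comp (rootSpan n).subtype)

/-- The diagonal forms `∑ aₖ xₖ²`. -/
def diagForm (n : ℕ) : (Fin (n + 1) → ℝ) →ₗ[ℝ] LatticeForm (rootLattice n) :=
  ∑ k, (LinearMap.proj k : (Fin (n + 1) → ℝ) →ₗ[ℝ] ℝ).smulRight
    (QuadraticMap.sq.comp (spanCoord k))

lemma diagForm_apply (a : Fin (n + 1) → ℝ) (x : rootSpan n) :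
    diagForm n a x = ∑ k, a k * ((x : Space n) k * (x : Space n) k) := by
  simp [diagForm, spanCoord]

lemma polar_diagForm (a : Fin (n + 1) → ℝ) (x y : rootSpan n) :
    QuadraticMap.polar (diagForm n a) x y =
      ∑ k, 2 * a k * ((x : Space n) k * (y : Space n) k) := by
  simp only [QuadraticMap.polar, diagForm_apply, ← Finset.sum_sub_distrib]
  refine Finset.sum_congr rfl fun k _ => ?_
  simp only [Submodule.coe_add, PiLp.add_apply]
  ring

lemma latticeForm_rootLattice : latticeForm (rootLattice n) = diagForm n fun _ => 1 := by
  ext x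
  rw [diagForm_apply]
  change inner ℝ (x : Space n) (x : Space n) = _
  simp only [PiLp.inner_apply, RCLike.inner_apply, conj_trivial, one_mul]

lemma posDef_diagForm {a : Fin (n + 1) → ℝ} (ha : ∀ k, 0 < a k) :
    (diagForm n a).PosDef := by
  intro x hx
  rw [diagForm_apply]
  have hne : ∃ k, (x : Space n) k ≠ 0 := by
    by_contra! h
    exact hx (Subtype.ext (PiLp.ext h))
  obtain ⟨k, hk⟩ := hne
  exact Finset.sum_pos' (fun k _ => mul_nonneg (ha k).le (mul_self_nonneg _))
    ⟨k, Finset.mem_univ k, mul_pos (ha k) (mul_self_pos.2 hk)⟩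

lemma polar_diagForm_spanRoot (a : Fin (n + 1) → ℝ) {i l k : Fin (n + 1)} (hil : i ≠ l)
    (hik : i ≠ k) (hlk : l ≠ k) :
    QuadraticMap.polar (diagForm n a) (spanRoot i l) (spanRoot i k) = 2 * a i := by
  rw [polar_diagForm, Finset.sum_eq_single i]
  · simp [spanRoot_apply, hil, hik]
  · intro m _ hm
    simp only [spanRoot_apply, hm, if_false]
    split_ifs with h1 h2 <;> first | exact absurd (h1.symm.trans h2) hlk | simp
  · simp

lemma exists_distinct (hn : 2 ≤ n) (i : Fin (n + 1)) : ∃ l k, i ≠ l ∧ i ≠ k ∧ l ≠ k := by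
  refine ⟨i + 1, i + 1 + 1, ne_add_one_of_two_le hn i, fun h => ?_,
    ne_add_one_of_two_le hn (i + 1)⟩
  rw [add_assoc, left_eq_add] at h
  exact two_ne_zero_of_two_le hn h

lemma exists_distinct_pair (hn : 2 ≤ n) (i j : Fin (n + 1)) : ∃ k, i ≠ k ∧ j ≠ k := by
  obtain ⟨l, k, h1, h2, h3⟩ := exists_distinct hn i
  by_cases h : j = k
  · exact ⟨l, h1, h ▸ h3.symm⟩
  · exact ⟨k, h2, h⟩

lemma diagForm_injective (hn : 2 ≤ n) : Function.Injective (diagForm n) := by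
  intro a a' h
  funext i
  obtain ⟨l, k, h1, h2, h3⟩ := exists_distinct hn i
  have h4 := polar_diagForm_spanRoot a h1 h2 h3
  rw [h, polar_diagForm_spanRoot a' h1 h2 h3] at h4
  linarith

/-- The lattice points at coordinatewise distance at most `1 / 2` from `y`. -/
def latticeCell (y : Fin (n + 1) → ℝ) : Set (rootSpan n) :=
  {z | (z : Space n) ∈ rootLattice n ∧ ∀ i, |(z : Space n) i - y i| ≤ 1 / 2}

lemma abs_sub_le_abs_sub_of_int {z w : ℤ} {y : ℝ} (hz : |(z : ℝ) - y| ≤ 1 / 2) :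
    |(z : ℝ) - y| ≤ |(w : ℝ) - y| := by
  rcases eq_or_ne z w with rfl | hne
  · exact le_rfl
  · have h1 : (1 : ℝ) ≤ |(z : ℝ) - w| := by
      have := Int.one_le_abs (sub_ne_zero.2 hne)
      exact_mod_cast this
    have h2 := abs_sub_le (z : ℝ) y w
    rw [abs_sub_comm y] at h2
    linarith

/-- Replacing `c` by `y` adds a multiple of the coordinate sum of `z`, which vanishes on the
hyperplane, and a constant, which cancels in the difference. The parameter `t` acts as the Lagrange
multiplier of the constraint of sum zero. -/
lemma diagForm_sub_sub {a : Fin (n + 1) → ℝ} (ha : ∀ k, 0 < a k) {c : rootSpan n}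
    {y : Fin (n + 1) → ℝ} {t : ℝ} (hy : ∀ i, y i = (c : Space n) i + t / a i)
    (z w : rootSpan n) :
    diagForm n a (z - c) - diagForm n a (w - c) =
      ∑ i, a i * ((z : Space n) i - y i) ^ 2 - ∑ i, a i * ((w : Space n) i - y i) ^ 2 := by
  have hz : ∀ z : rootSpan n, diagForm n a (z - c) =
      ∑ i, a i * ((z : Space n) i - y i) ^ 2 + ∑ i, (t ^ 2 / a i - 2 * t * y i) := by
    intro z
    have hz0 : ∑ i, 2 * t * (z : Space n) i = 0 := by
      rw [← Finset.mul_sum, mem_span_rootLattice_iff.1 z.2, mul_zero]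
    rw [diagForm_apply, ← add_zero (∑ i, a i * _ + _), ← hz0, ← Finset.sum_add_distrib,
      ← Finset.sum_add_distrib]
    refine Finset.sum_congr rfl fun i _ => ?_
    rw [Submodule.coe_sub, PiLp.sub_apply, hy i]
    have := (ha i).ne'
    field_simp
    ring
  rw [hz, hz]
  ring

/-- With centre `y` the objective is separable, and a point of the cell minimizes every term over
the integers. Once the cell is nonempty, a minimizer must attain all these minima simultaneously,
whatever the weights. -/
lemma closest_eq_latticeCell {a : Fin (n + 1) → ℝ} (ha : ∀ k, 0 < a k) {c : rootSpan n}
    {y : Fin (n + 1) → ℝ} {t : ℝ} (hy : ∀ i, y i = (c : Space n) i + t / a i)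
    (hne : (latticeCell y).Nonempty) :
    {z : rootSpan n | (z : Space n) ∈ rootLattice n ∧ ∀ w : rootSpan n,
      (w : Space n) ∈ rootLattice n → diagForm n a (z - c) ≤ diagForm n a (w - c)} =
      latticeCell y := by
  have hle : ∀ z ∈ latticeCell y, ∀ w : rootSpan n, (w : Space n) ∈ rootLattice n → ∀ i,
      a i * ((z : Space n) i - y i) ^ 2 ≤ a i * ((w : Space n) i - y i) ^ 2 := by
    intro z hz w hw i
    refine mul_le_mul_of_nonneg_left (sq_le_sq.2 ?_) (ha i).le
    obtain ⟨zi, hzi⟩ := exists_int_of_mem_rootLattice hz.1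
    obtain ⟨wi, hwi⟩ := exists_int_of_mem_rootLattice hw
    have := hz.2 i
    rw [hzi] at this ⊢
    rw [hwi]
    exact abs_sub_le_abs_sub_of_int this
  ext z
  constructor
  · rintro ⟨hz, hopt⟩
    obtain ⟨z₀, hz₀⟩ := hne
    refine ⟨hz, fun i => ?_⟩
    have h1 := hopt z₀ hz₀.1
    rw [← sub_nonpos, diagForm_sub_sub ha hy, sub_nonpos] at h1
    have h2 := (Finset.sum_eq_sum_iff_of_le fun i _ => hle z₀ hz₀ z hz i).1
      (le_antisymm (Finset.sum_le_sum fun i _ => hle z₀ hz₀ z hz i) h1) i (Finset.mem_univ i)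
    have h3 := mul_left_cancel₀ (ha i).ne' h2
    rw [sq_eq_sq_iff_abs_eq_abs] at h3
    rw [← h3]
    exact hz₀.2 i
  · intro hz
    refine ⟨hz.1, fun w hw => ?_⟩
    rw [← sub_nonpos, diagForm_sub_sub ha hy, sub_nonpos]
    exact Finset.sum_le_sum fun i _ => hle z hz w hw i

lemma finite_diagForm_le {a : Fin (n + 1) → ℝ} (ha : ∀ k, 0 < a k) (c : rootSpan n) (K : ℝ) :
    {z : rootSpan n | (z : Space n) ∈ rootLattice n ∧ diagForm n a (z - c) ≤ K}.Finite := by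
  have hfin : ((fun z : Fin (n + 1) → ℤ => (WithLp.toLp 2 fun i => (z i : ℝ) : Space n)) ''
      Set.Icc (fun i => ⌊(c : Space n) i - (K / a i + 1)⌋)
        (fun i => ⌈(c : Space n) i + (K / a i + 1)⌉)).Finite := (Set.finite_Icc _ _).image _
  refine (hfin.preimage Subtype.val_injective.injOn).subset ?_
  rintro z ⟨hz, hK⟩
  obtain ⟨zi, hzi⟩ := exists_int_of_mem_rootLattice hz
  -- A crude bound avoiding square roots: s² ≤ q implies s ≤ q + 1.
  have hbound : ∀ i, |(zi i : ℝ) - (c : Space n) i| ≤ K / a i + 1 := by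
    intro i
    rw [diagForm_apply] at hK
    have h1 := (Finset.single_le_sum (f := fun k => a k * (((z - c : rootSpan n) : Space n) k *
      ((z - c : rootSpan n) : Space n) k)) (fun k _ => mul_nonneg (ha k).le (mul_self_nonneg _))
      (Finset.mem_univ i)).trans hK
    simp only [Submodule.coe_sub, PiLp.sub_apply, hzi] at h1
    have h2 : ((zi i : ℝ) - (c : Space n) i) * ((zi i : ℝ) - (c : Space n) i) ≤ K / a i := by
      rw [le_div_iff₀ (ha i)]
      linarith
    rw [← abs_mul_abs_self] at h2
    nlinarith [sq_nonneg (|(zi i : ℝ) - (c : Space n) i| - 1)]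
  refine ⟨zi, ⟨fun i => ?_, fun i => ?_⟩, ?_⟩
  · rw [← Int.cast_le (R := ℝ)]
    refine (Int.floor_le _).trans ?_
    linarith [(abs_le.1 (hbound i)).1]
  · rw [← Int.cast_le (R := ℝ)]
    refine le_trans ?_ (Int.le_ceil _)
    linarith [(abs_le.1 (hbound i)).2]
  · exact PiLp.ext fun i => (hzi i).symm

lemma exists_closest {a : Fin (n + 1) → ℝ} (ha : ∀ k, 0 < a k) (c : rootSpan n) :
    ∃ z : rootSpan n, (z : Space n) ∈ rootLattice n ∧ ∀ w : rootSpan n,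
      (w : Space n) ∈ rootLattice n → diagForm n a (z - c) ≤ diagForm n a (w - c) := by
  obtain ⟨z, hz, hmin⟩ := Set.exists_min_image _ (fun z => diagForm n a (z - c))
    (finite_diagForm_le ha c (diagForm n a (0 - c))) ⟨0, Submodule.zero_mem _, le_rfl⟩
  refine ⟨z, hz.1, fun w hw => ?_⟩
  by_cases h : diagForm n a (w - c) ≤ diagForm n a (0 - c)
  · exact hmin w ⟨hw, h⟩
  · exact hz.2.trans (not_le.1 h).le

lemma diagForm_add_spanRoot (a : Fin (n + 1) → ℝ) (d : rootSpan n) {i j : Fin (n + 1)}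
    (hij : i ≠ j) :
    diagForm n a (d + spanRoot i j) = diagForm n a d +
      (a i * (2 * (d : Space n) i + 1) - a j * (2 * (d : Space n) j - 1)) := by
  rw [← sub_eq_iff_eq_add', diagForm_apply, diagForm_apply, ← Finset.sum_sub_distrib,
    Fintype.sum_eq_add i j hij]
  · simp only [Submodule.coe_add, PiLp.add_apply, spanRoot_apply, hij, hij.symm, if_true, if_false]
    ring
  · rintro m ⟨h1, h2⟩
    simp [spanRoot_apply, h1, h2]

/-- With d = z - c, the shift must satisfy a_i(2d_i - 1) ≤ 2t ≤ a_i(2d_i + 1) for all i. Optimality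
against the neighbours `z + spanRoot i j` says that every lower bound is at most every upper bound,
so the largest lower bound serves as 2t. -/
lemma exists_shift_of_closest {a : Fin (n + 1) → ℝ} (ha : ∀ k, 0 < a k) {c z : rootSpan n}
    (hz : (z : Space n) ∈ rootLattice n)
    (hopt : ∀ w : rootSpan n, (w : Space n) ∈ rootLattice n →
      diagForm n a (z - c) ≤ diagForm n a (w - c)) :
    ∃ t : ℝ, z ∈ latticeCell fun i => (c : Space n) i + t / a i := by
  have hex : ∀ i j, a j * (2 * ((z - c : rootSpan n) : Space n) j - 1) ≤
      a i * (2 * ((z - c : rootSpan n) : Space n) i + 1) := by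
    intro i j
    rcases eq_or_ne i j with rfl | hij
    · exact mul_le_mul_of_nonneg_left (by linarith) (ha i).le
    · have h := hopt (z + spanRoot i j) (Submodule.add_mem _ hz (root_mem_rootLattice i j))
      rw [add_sub_right_comm, diagForm_add_spanRoot a _ hij] at h
      linarith
  obtain ⟨j, -, hj⟩ := Finset.exists_max_image Finset.univ
    (fun j => a j * (2 * ((z - c : rootSpan n) : Space n) j - 1)) ⟨0, Finset.mem_univ _⟩
  refine ⟨a j * (2 * ((z - c : rootSpan n) : Space n) j - 1) / 2, hz, fun i => ?_⟩
  set t := a j * (2 * ((z - c : rootSpan n) : Space n) j - 1) with ht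
  have h1 := hj i (Finset.mem_univ i)
  have h2 := hex i j
  simp only [Submodule.coe_sub, PiLp.sub_apply] at h1 h2
  have h3 : t / 2 / a i ≤ (z : Space n) i - (c : Space n) i + 1 / 2 := by
    rw [div_le_iff₀ (ha i)]
    simp only [ht, Submodule.coe_sub, PiLp.sub_apply]
    linarith
  have h4 : (z : Space n) i - (c : Space n) i - 1 / 2 ≤ t / 2 / a i := by
    rw [le_div_iff₀ (ha i)]
    linarith
  rw [abs_le]
  constructor <;> linarith

lemma delaunaySubdivision_diagForm {a : Fin (n + 1) → ℝ} (ha : ∀ k, 0 < a k) :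
    delaunaySubdivision (rootLattice n) (diagForm n a) =
      {D | ∃ y, (latticeCell y).Nonempty ∧ D = latticeCell y} := by
  ext D
  constructor
  · rintro ⟨c, rfl⟩
    obtain ⟨z, hz, hopt⟩ := exists_closest ha c
    obtain ⟨t, ht⟩ := exists_shift_of_closest ha hz hopt
    exact ⟨_, ⟨z, ht⟩, closest_eq_latticeCell ha (fun _ => rfl) ⟨z, ht⟩⟩
  · rintro ⟨y, hne, rfl⟩
    have hpos : 0 < ∑ i, 1 / a i :=
      Finset.sum_pos (fun i _ => one_div_pos.2 (ha i)) ⟨0, Finset.mem_univ _⟩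
    -- This is the value for which the centre `y i - t / a i` has coordinate sum zero.
    let t : ℝ := (∑ i, y i) / ∑ i, 1 / a i
    let c : rootSpan n := ⟨WithLp.toLp 2 fun i => y i - t / a i, by
      rw [mem_span_rootLattice_iff]
      have : ∑ i, t / a i = t * ∑ i, 1 / a i := by
        rw [Finset.mul_sum]
        exact Finset.sum_congr rfl fun i _ => (mul_one_div _ _).symm
      rw [Finset.sum_sub_distrib, this, div_mul_cancel₀ _ hpos.ne', sub_self]⟩
    exact ⟨c, (closest_eq_latticeCell ha (t := t) (fun i => (sub_add_cancel _ _).symm) hne).symm⟩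

/-- A parallelogram whose vertices are equidistant from a point is a rectangle: the alternating sum
of `f` over its four vertices, each taken relative to `c`, is the polar form of the sides. -/
lemma polar_eq_zero_of_closest {V : Type*} [AddCommGroup V] [Module ℝ V] {f : QuadraticForm ℝ V}
    {c u v : V} (h1 : f (u - c) = f (0 - c)) (h2 : f (v - c) = f (0 - c))
    (h3 : f (u + v - c) = f (0 - c)) : QuadraticMap.polar f u v = 0 := by
  have h4 : QuadraticMap.polar f (u + v) (-c) =
      QuadraticMap.polar f u (-c) + QuadraticMap.polar f v (-c) :=
    QuadraticMap.polar_add_left f _ _ _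
  simp only [QuadraticMap.polar, ← sub_eq_add_neg] at h4 ⊢
  rw [zero_sub] at h1 h2 h3
  linarith

/-- Roots with disjoint supports span a parallelogram whose coordinates each take the value 0 or
that of the opposite vertex, of size at most 1. All four vertices are thus within 1/2 of the centre
`y` in each coordinate and lie in one Delaunay cell. -/
lemma polar_spanRoot_eq_zero {f : LatticeForm (rootLattice n)}
    (hf : delaunaySubdivision (rootLattice n) f =
      delaunaySubdivision (rootLattice n) (latticeForm (rootLattice n)))
    {i l j k : Fin (n + 1)} (hij : i ≠ j) (hik : i ≠ k) (hlj : l ≠ j) (hlk : l ≠ k) :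
    QuadraticMap.polar f (spanRoot i l) (spanRoot j k) = 0 := by
  let y : Fin (n + 1) → ℝ := fun m => ((spanRoot i l + spanRoot j k : rootSpan n) : Space n) m / 2
  have hcase : ∀ m, (spanRoot i l : Space n) m = 0 ∨ (spanRoot j k : Space n) m = 0 := by
    intro m
    by_cases hm : m = j ∨ m = k
    · left
      rcases hm with rfl | rfl
      · exact spanRoot_apply_of_ne hij.symm hlj.symm
      · exact spanRoot_apply_of_ne hik.symm hlk.symm
    · push Not at hm
      exact Or.inr (spanRoot_apply_of_ne hm.1 hm.2)
  have hy : ∀ z : rootSpan n, (z : Space n) ∈ rootLattice n →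
      (∀ m, (z : Space n) m = 0 ∨
        (z : Space n) m = ((spanRoot i l + spanRoot j k : rootSpan n) : Space n) m) →
      z ∈ latticeCell y := by
    refine fun z hz hm => ⟨hz, fun m => ?_⟩
    have h1 : |((spanRoot i l + spanRoot j k : rootSpan n) : Space n) m| ≤ 1 := by
      rw [Submodule.coe_add, PiLp.add_apply]
      rcases hcase m with h | h
      · rw [h, zero_add]
        exact abs_spanRoot_le_one j k m
      · rw [h, add_zero]
        exact abs_spanRoot_le_one i l m
    have h2 : |y m| ≤ 1 / 2 := by
      rw [abs_div, abs_two]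
      linarith
    rcases hm m with h | h
    · rwa [h, zero_sub, abs_neg]
    · have : (z : Space n) m - y m = y m := by
        rw [h]
        simp only [y]
        ring
      rwa [this]
  have h0 : (0 : rootSpan n) ∈ latticeCell y :=
    hy 0 (Submodule.zero_mem _) fun m => Or.inl rfl
  have hu : spanRoot i l ∈ latticeCell y := by
    refine hy _ (root_mem_rootLattice i l) fun m => ?_
    rw [Submodule.coe_add, PiLp.add_apply]
    exact (hcase m).imp id fun h => by rw [h, add_zero]
  have hv : spanRoot j k ∈ latticeCell y := by
    refine hy _ (root_mem_rootLattice j k) fun m => ?_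
    rw [Submodule.coe_add, PiLp.add_apply]
    exact (hcase m).symm.imp id fun h => by rw [h, zero_add]
  have huv : spanRoot i l + spanRoot j k ∈ latticeCell y :=
    hy _ (Submodule.add_mem _ (root_mem_rootLattice i l) (root_mem_rootLattice j k))
      fun m => Or.inr rfl
  have hmem : latticeCell y ∈ delaunaySubdivision (rootLattice n) f := by
    rw [hf, latticeForm_rootLattice, delaunaySubdivision_diagForm fun _ => one_pos]
    exact ⟨y, ⟨0, h0⟩, rfl⟩
  obtain ⟨c, hc⟩ := hmem
  have heq : ∀ z ∈ latticeCell y, f (z - c) = f (0 - c) := by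
    intro z hz
    have h0' := h0
    rw [hc] at hz h0'
    exact le_antisymm (hz.2 0 (Submodule.zero_mem _)) (h0'.2 z hz.1)
  exact polar_eq_zero_of_closest (heq _ hu) (heq _ hv) (heq _ huv)

lemma polar_spanRoot_swap (f : LatticeForm (rootLattice n)) (i j k l : Fin (n + 1)) :
    QuadraticMap.polar f (spanRoot i j) (spanRoot k l) =
      QuadraticMap.polar f (spanRoot j i) (spanRoot l k) := by
  rw [← neg_spanRoot j i, ← neg_spanRoot l k, QuadraticMap.polar_neg_left,
    QuadraticMap.polar_neg_right, neg_neg]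

/-- The numbers α determine the Gram matrix in the basis of the `spanRoot i 0` with i ≠ 0, and hence
the form. A diagonal entry is split as (e_i - e_k) + (e_k - e_0) through a third index. -/
lemma polar_spanRoot_base {f : LatticeForm (rootLattice n)} {α : Fin (n + 1) → ℝ} (hn : 2 ≤ n)
    (hα : ∀ i l k, i ≠ l → i ≠ k → l ≠ k →
      QuadraticMap.polar f (spanRoot i l) (spanRoot i k) = α i) (i j : Fin (n + 1)) :
    QuadraticMap.polar f (spanRoot i 0) (spanRoot j 0) =
      if i = 0 ∨ j = 0 then 0 else if i = j then α i + α 0 else α 0 := by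
  split_ifs with h h'
  · rcases h with rfl | rfl
    · rw [spanRoot_self, QuadraticMap.polar_zero_left]
    · rw [spanRoot_self, QuadraticMap.polar_zero_right]
  · subst h'
    have hi : i ≠ 0 := fun h0 => h (Or.inl h0)
    obtain ⟨k, h1, h2⟩ := exists_distinct_pair hn i 0
    have h3 : QuadraticMap.polar f (spanRoot i 0) (spanRoot i k + spanRoot k 0) =
        QuadraticMap.polar f (spanRoot i 0) (spanRoot i k) +
        QuadraticMap.polar f (spanRoot i 0) (spanRoot k 0) := QuadraticMap.polar_add_right f _ _ _
    rw [spanRoot_add, hα i 0 k hi h1 h2, polar_spanRoot_swap f i 0 k 0, hα 0 i k hi.symm h2 h1] at h3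
    exact h3
  · push Not at h
    rw [polar_spanRoot_swap, hα 0 i j h.1.symm h.2.symm h']

lemma eq_of_polar_spanRoot_base_eq {f g : LatticeForm (rootLattice n)}
    (h : ∀ i j, QuadraticMap.polar f (spanRoot i 0) (spanRoot j 0) =
      QuadraticMap.polar g (spanRoot i 0) (spanRoot j 0)) : f = g := by
  ext x
  have hx : x = ∑ i, (x : Space n) i • spanRoot i 0 := by
    apply Subtype.ext
    rw [AddSubmonoidClass.coe_finsetSum]
    exact eq_sum_smul_root (mem_span_rootLattice_iff.1 x.2) 0
  have key : ∀ f : LatticeForm (rootLattice n), 2 * f x =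
      ∑ i, ∑ j, (x : Space n) i * ((x : Space n) j *
        QuadraticMap.polar f (spanRoot i 0) (spanRoot j 0)) := by
    intro f
    have h1 : f.polarBilin x x = 2 * f x := by
      rw [QuadraticMap.polarBilin_apply_apply, QuadraticMap.polar_self, two_smul, two_mul]
    rw [← h1]
    conv_lhs => rw [hx]
    simp only [map_sum, map_smul, LinearMap.sum_apply, LinearMap.smul_apply, smul_eq_mul,
      QuadraticMap.polarBilin_apply_apply, Finset.mul_sum]
    rw [Finset.sum_comm]
    refine Finset.sum_congr rfl fun i _ => Finset.sum_congr rfl fun j _ => ?_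
    ring
  have h1 := key f
  have h2 := key g
  simp only [h] at h1
  linarith

/-- Replacing `k` by `k'` changes `spanRoot i k` by a root disjoint from `i` and `l`, which
contributes nothing. Such replacements, with the symmetry of the polar form, connect any two pairs
(l, k). -/
lemma exists_polar_spanRoot_eq {f : LatticeForm (rootLattice n)} (hn : 2 ≤ n)
    (hf : ∀ i l j k, i ≠ l → i ≠ j → i ≠ k → l ≠ j → l ≠ k → j ≠ k →
      QuadraticMap.polar f (spanRoot i l) (spanRoot j k) = 0) :
    ∃ α : Fin (n + 1) → ℝ, ∀ i l k, i ≠ l → i ≠ k → l ≠ k →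
      QuadraticMap.polar f (spanRoot i l) (spanRoot i k) = α i := by
  have hright : ∀ i l k k', i ≠ l → i ≠ k → l ≠ k → i ≠ k' → l ≠ k' →
      QuadraticMap.polar f (spanRoot i l) (spanRoot i k) =
        QuadraticMap.polar f (spanRoot i l) (spanRoot i k') := by
    intro i l k k' h1 h2 h3 h4 h5
    rcases eq_or_ne k k' with rfl | hk
    · rfl
    · rw [← spanRoot_add i k' k, QuadraticMap.polar_add_right,
        hf i l k' k h1 h4 h2 h5 h3 hk.symm, add_zero]
  have hleft : ∀ i l l' k, i ≠ l → i ≠ k → l ≠ k → i ≠ l' → l' ≠ k →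
      QuadraticMap.polar f (spanRoot i l) (spanRoot i k) =
        QuadraticMap.polar f (spanRoot i l') (spanRoot i k) := by
    intro i l l' k h1 h2 h3 h4 h5
    rw [QuadraticMap.polar_comm f _ (spanRoot i k), QuadraticMap.polar_comm f _ (spanRoot i k)]
    exact hright i k l l' h2 h1 h3.symm h4 h5.symm
  choose l k h1 h2 h3 using exists_distinct hn
  refine ⟨fun i => QuadraticMap.polar f (spanRoot i (l i)) (spanRoot i (k i)),
    fun i l' k' h4 h5 h6 => ?_⟩
  -- A replacement must keep the two indices distinct, so the order of replacements depends on
  -- coincidences; when the pair is merely swapped, symmetry alone suffices.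
  by_cases hlk : l i = k'
  · by_cases hkl : k i = l'
    · dsimp only
      rw [hlk, hkl, QuadraticMap.polar_comm]
    · rw [hright i l' k' (k i) h4 h5 h6 (h2 i) (Ne.symm hkl)]
      exact hleft i l' (l i) (k i) h4 (h2 i) (Ne.symm hkl) (h1 i) (h3 i)
  · rw [hleft i l' (l i) k' h4 h5 h6 (h1 i) hlk]
    exact hright i (l i) k' (k i) (h1 i) h5 hlk (h2 i) (h3 i)

lemma formTypeDomain_subset_range (hn : 2 ≤ n) :
    formTypeDomain (rootLattice n) (latticeForm (rootLattice n)) ⊆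
      LinearMap.range (diagForm n) := by
  rintro f ⟨-, hf⟩
  obtain ⟨α, hα⟩ := exists_polar_spanRoot_eq hn
    fun i l j k _ h2 h3 h4 h5 _ => polar_spanRoot_eq_zero hf h2 h3 h4 h5
  refine ⟨fun i => α i / 2, eq_of_polar_spanRoot_base_eq fun i j => ?_⟩
  rw [polar_spanRoot_base hn hα, polar_spanRoot_base hn]
  intro i l k h1 h2 h3
  rw [polar_diagForm_spanRoot _ h1 h2 h3]
  ring

/-- The type domain lies between the positive diagonal forms and the space of all diagonal forms,
and both span the same space, of dimension n + 1. -/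
lemma nrdLattice_rootLattice (hn : 2 ≤ n) : nrdLattice (rootLattice n) = n + 1 := by
  have hne : {a : Fin (n + 1) → ℝ | ∀ m, 0 < a m}.Nonempty := ⟨fun _ => 1, fun _ => one_pos⟩
  have hsub : diagForm n '' {a | ∀ m, 0 < a m} ⊆
      formTypeDomain (rootLattice n) (latticeForm (rootLattice n)) := by
    rintro _ ⟨a, ha, rfl⟩
    refine ⟨posDef_diagForm ha, ?_⟩
    rw [latticeForm_rootLattice, delaunaySubdivision_diagForm ha,
      delaunaySubdivision_diagForm fun _ => one_pos]
  have hspan : vectorSpan ℝ (formTypeDomain (rootLattice n) (latticeForm (rootLattice n))) =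
      LinearMap.range (diagForm n) := by
    apply le_antisymm
    · rw [vectorSpan_def, Submodule.span_le]
      rintro _ ⟨f, hf, g, hg, rfl⟩
      exact Submodule.sub_mem _ (formTypeDomain_subset_range hn hf)
        (formTypeDomain_subset_range hn hg)
    · rw [← vectorSpan_image_of_isOpen _ (isOpen_positive_orthant _) hne]
      exact vectorSpan_mono ℝ hsub
  rw [nrdLattice, setDim, hspan, LinearMap.finrank_range_of_inj (diagForm_injective hn),
    Module.finrank_fin_fun]

end NonRigidity

end CircuitZonotope

end

theorem mainTheorem5 (n : ℕ) (C : SimpleGraph (Fin (n + 1)))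
    (hC : CircuitZonotope.IsHamiltonianCircuit C)
    (b : Sym2 (Fin (n + 1)) → ℝ) (hb : ∀ e ∈ C.edgeSet, 0 < b e) :
    -- the zonotope is `n`-dimensional and cubical
    CircuitZonotope.setDim (CircuitZonotope.zonotope C b) = n ∧
    CircuitZonotope.IsCubical (CircuitZonotope.zonotope C b) ∧
    -- it has the type of the Voronoi polytope of the root lattice
    CircuitZonotope.SameType (CircuitZonotope.zonotope C b)
      (CircuitZonotope.voronoiPolytope (CircuitZonotope.rootLattice n)) ∧
    -- its facet vectors are, up to sign, the incidence vectors of the subchains of `C - {0}`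
    CircuitZonotope.facetVectors (CircuitZonotope.zonotope C b) =
      {p | ∃ S, CircuitZonotope.IsSubchain C S ∧
        (p = CircuitZonotope.incidenceVector S ∨ p = -CircuitZonotope.incidenceVector S)} ∧
    -- each facet has exactly one facet vector
    (∀ F, CircuitZonotope.IsFacet (CircuitZonotope.zonotope C b) F →
      ∃! p, p ∈ CircuitZonotope.facetVectors (CircuitZonotope.zonotope C b) ∧
        F = CircuitZonotope.supportFace (CircuitZonotope.zonotope C b) p) ∧
    -- there are `n (n + 1) / 2` of them up to sign
    2 * {S | CircuitZonotope.IsSubchain C S}.ncard = n * (n + 1) ∧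
    -- they form a unimodular set equivalent to `𝔸ₙ`, the set of facet vectors of `P_V(Aₙ)`
    CircuitZonotope.IsUnimodularSet
      (CircuitZonotope.facetVectors (CircuitZonotope.zonotope C b)) ∧
    CircuitZonotope.LinearlyEquivalent
      (CircuitZonotope.facetVectors (CircuitZonotope.zonotope C b))
      (CircuitZonotope.rootSystem n) ∧
    CircuitZonotope.voronoiFacetVectors (CircuitZonotope.rootLattice n) =
      CircuitZonotope.rootSystem n ∧
    -- the zonotope is the base polytope of the cut function, whose type domain is the open cone
    -- of the circuit and has dimension `n + 1`
    CircuitZonotope.zonotope C b =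
      CircuitZonotope.basePolytope (CircuitZonotope.cutFunction C b) ∧
    CircuitZonotope.typeDomain (CircuitZonotope.cutFunction C b) =
      CircuitZonotope.openCutCone C ∧
    CircuitZonotope.setDim (CircuitZonotope.typeDomain (CircuitZonotope.cutFunction C b)) =
      n + 1 ∧
    -- which is also the non-rigidity degree of the root lattice
    CircuitZonotope.nrdLattice (CircuitZonotope.rootLattice n) = n + 1 := by
  obtain ⟨φ, hφ⟩ := hC.exists_param
  have hpos := hφ.weight_pos hb
  have hc := CircuitZonotope.isPositiveCircuit_circuitVec hpos
  have hfacets := CircuitZonotope.facetVectors_zon_circuitVec hφ.map_zero hpos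
  have hdim := hc.setDim_zon
  rw [Fintype.card_fin, Nat.add_right_cancel_iff] at hdim
  refine ⟨?_, ?_, ?_, ?_, ?_, hφ.two_mul_ncard_subchains, ?_, ?_,
    CircuitZonotope.voronoiFacetVectors_rootLattice n,
    CircuitZonotope.zonotope_eq_basePolytope fun e he => (hb e he).le, hφ.typeDomain_eq hb, ?_,
    CircuitZonotope.nrdLattice_rootLattice hφ.two_le⟩
  · rwa [hφ.zonotope_eq]
  · rw [hφ.zonotope_eq]
    exact hc.isCubical
  · rw [hφ.zonotope_eq, CircuitZonotope.voronoiPolytope_rootLattice]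
    exact hc.sameType (CircuitZonotope.isPositiveCircuit_halfProj n)
  · rw [hφ.zonotope_eq, hfacets, CircuitZonotope.image_tailSum_rootSystem hφ]
  · rw [hφ.zonotope_eq]
    exact fun F hF => CircuitZonotope.existsUnique_facetVector hφ.map_zero hpos hF
  · rw [hφ.zonotope_eq, hfacets]
    exact CircuitZonotope.isUnimodularSet_image_rootSystem (CircuitZonotope.tailSumEquiv φ)
  · rw [hφ.zonotope_eq, hfacets]
    refine ⟨(CircuitZonotope.tailSumEquiv φ).symm, ?_⟩
    exact (CircuitZonotope.tailSumEquiv φ).toEquiv.symm_image_image (CircuitZonotope.rootSystem n)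
  · rw [hφ.typeDomain_eq hb, hφ.setDim_openCutCone]
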